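/- Let $[m]=\{1,\dots,m\}$. A $k$-graph $H$ is a finite vertex set $V(H)$ together with a set of $k$-element subsets of $V(H)$, its edges; $v(H)=|V(H)|$. For $x\in V(H)$, the link $L_H(x)$ is the $(k-1)$-graph with vertex set $V(H)\setminus\{x\}$ whose edges are the sets $T$ with $T\cup\{x\}\in H$ and $x\notin T$. An antichain is a family of sets none of which is a proper subset of another; an antichain $\mathcal{I}\subseteq 2^{X}$ is full if $|\mathcal{I}|\ge 2$ and every $x\in X$ lies in some $I\in\mathcal{I}$. For an antichain $\mathcal{I}\subseteq 2^{[k]}$, an $\mathcal{I}$-layout in a $k$-graph $H$ is a family $\Lambda=(\lambda_I)_{I\in\mathcal{I}}$ in which $\lambda_I$ is an $|I|$-uniform hypergraph on $V(H)$. Let $K_k(\Lambda)$ be the set of tuples $(x_1,\dots,x_k)$ of distinct vertices with $\{x_i:i\in I\}\in\lambda_I$ for all $I\in\mathcal{I}$, and let $H\cap K_k(\Lambda)$ be the set of those tuples in $K_k(\Lambda)$ with $\{x_1,\dots,x_k\}\in H$. The $k$-graph $H$ satisfies $\mathrm{Disc}^{(k)}(\mathcal{I},\ge p,\mu)$ if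 $|H\cap K_k(\Lambda)|\ge p\,|K_k(\Lambda)|-\mu\, v(H)^k$ for every $\mathcal{I}$-layout $\Lambda$ in $H$. A $k$-graph $F$ is $\mathcal{I}$-adapted if there are an ordering $E_1,\dots,E_m$ of its edges and bijections $\phi_i:E_i\to[k]$ such that for all $1\le j<i\le m$ there is an $I\in\mathcal{I}$ with $\phi_i(E_i\cap E_j)\subseteq I$. For antichains $\mathcal{I}\subseteq 2^{[k]}$ and $\mathcal{J}\subseteq 2^{[k-1]}$, $F$ is $(\mathcal{I},\mathcal{J})$-adapted if it is $\mathcal{I}$-adapted and there are a vertex $x\in V(F)$, an ordering $E_1,\dots,E_m$ of the edges of $F$ and bijections $\psi_i:E_i\to[k]$ such that for all $1\le j<i\le m$: if $x\notin E_i$, then $\psi_i(E_i\cap E_j)\subseteq I$ for some $I\in\mathcal{I}$; and if $x\in E_i$, then $\psi_i(x)=k$ and $\psi_i((E_i\cap E_j)\setminus\{x\})\subseteq J$ for some $J\in\mathcal{J}$. A $k$-graph $H$ has a perfect $F$-packing if $V(H)$ can be partitioned into the vertex sets of copies of $F$ in $H$ (images of $V(F)$ under injections $V(F)\to V(H)$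 that map edges to edges). **Theorem.** Let $k\ge 2$, let $\mathcal{I}\subseteq 2^{[k]}$ be a full antichain, let $\mathcal{J}\subseteq 2^{[k-1]}$ be an antichain, and let $0<\alpha,p<1$. For every $(\mathcal{I},\mathcal{J})$-adapted $k$-graph $F$ there are $\mu>0$ and $n_0$ such that the following holds. Let $H$ be an $n$-vertex $k$-graph with $n\ge n_0$ and $v(F)\mid n$. If $H$ satisfies $\mathrm{Disc}^{(k)}(\mathcal{I},\ge p,\mu)$ and $L_H(x)$ satisfies $\mathrm{Disc}^{(k-1)}(\mathcal{J},\ge\alpha,\mu)$ for every $x\in V(H)$, then $H$ has a perfect $F$-packing. -/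

import Mathlib

/-- An `r`-uniform hypergraph (`r`-graph) with vertex set the whole type `V`:
a collection of `r`-element sets of vertices. -/
@[ext]
structure UniformHypergraph (V : Type*) (r : ℕ) where
  /-- the edge set -/
  edges : Set (Finset V)
  /-- every edge has exactly `r` vertices -/
  uniform : ∀ e ∈ edges, e.card = r

namespace UniformHypergraph

/-- The link of the vertex `x` in the `k`-graph `H`: the `(k-1)`-graph with vertex set `V ∖ {x}`,
whose edges are the sets `T ⊆ V ∖ {x}` with `T ∪ {x}` an edge of `H`. -/
def link {V : Type*} {k : ℕ} (H : UniformHypergraph V k) (x : V) :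
    UniformHypergraph {y : V // y ≠ x} (k - 1) where
  edges := {T | Finset.cons x (T.map (Function.Embedding.subtype fun y : V => y ≠ x)) (by simp)
    ∈ H.edges}
  uniform := by
    intro T hT
    have h := H.uniform _ hT
    rw [Finset.card_cons, Finset.card_map] at h
    omega

/-- A labeled copy of `F` in `H`: an edge-preserving injection of vertex sets. -/
def IsLabeledCopy {W V : Type*} {k : ℕ} (F : UniformHypergraph W k) (H : UniformHypergraph V k)
    (q : W ↪ V) : Prop :=
  ∀ e ∈ F.edges, e.map q ∈ H.edges

/-- `H` has a perfect `F`-packing: the vertex set of `H` can be partitioned into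
(the vertex sets of) copies of `F`. -/
def HasPerfectPacking {W V : Type*} {k : ℕ} (F : UniformHypergraph W k)
    (H : UniformHypergraph V k) : Prop :=
  ∃ (t : ℕ) (q : Fin t → W ↪ V),
    (∀ i, F.IsLabeledCopy H (q i)) ∧
    (∀ i j, i ≠ j → Disjoint (Set.range (q i)) (Set.range (q j))) ∧
    (⋃ i, Set.range (q i)) = Set.univ

end UniformHypergraph

/-- A full antichain in `2^X`: an antichain with at least two members whose union is `X`. -/
def IsFullAntichain {X : Type*} (I : Finset (Finset X)) : Prop :=
  IsAntichain (· ⊆ ·) (I : Set (Finset X)) ∧ 2 ≤ I.card ∧ ∀ x : X, ∃ A ∈ I, x ∈ A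

/-- An `𝓘`-layout on the vertex set `V`: an `|I|`-uniform hypergraph on `V` for each `I ∈ 𝓘`.
The index set `[k]` is represented by `Fin k`, the label `i` being `i - 1 : Fin k`. -/
abbrev Layout {k : ℕ} (I : Finset (Finset (Fin k))) (V : Type*) : Type _ :=
  ∀ A : {A : Finset (Fin k) // A ∈ I}, UniformHypergraph V A.1.card

/-- The `k`-cliques of a layout: the tuples of `k` distinct vertices (that is, embeddings
`Fin k ↪ V`) for which `{x_i : i ∈ A} ∈ λ_A` for every `A ∈ 𝓘`. -/
def Layout.cliques {k : ℕ} {I : Finset (Finset (Fin k))} {V : Type*} (L : Layout I V) :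
    Set (Fin k ↪ V) :=
  {x | ∀ A, A.1.map x ∈ (L A).edges}

/-- The one-sided discrepancy property `Disc^{(k)}(𝓘, ≥ p, μ)` of a `k`-graph on a finite
vertex set: `|H ∩ K_k(Λ)| ≥ p |K_k(Λ)| - μ n^k` for every `𝓘`-layout `Λ`. -/
def UniformHypergraph.Disc {V : Type*} {k : ℕ} (H : UniformHypergraph V k)
    (I : Finset (Finset (Fin k))) (p μ : ℝ) : Prop :=
  ∀ L : Layout I V,
    p * (L.cliques.ncard : ℝ) - μ * (Nat.card V : ℝ) ^ k ≤
      (({x ∈ L.cliques | Finset.univ.map x ∈ H.edges}).ncard : ℝ)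

/-- `F` is `𝓘`-adapted: there are an ordering `E_0, …, E_{m-1}` of the edges of `F` and bijections
`φ_i : E_i → [k]` such that, for all `j < i`, some `A ∈ 𝓘` contains `φ_i(E_j ∩ E_i)`. -/
def UniformHypergraph.IsAdapted {W : Type*} {k : ℕ} (F : UniformHypergraph W k)
    (I : Finset (Finset (Fin k))) : Prop :=
  ∃ (m : ℕ) (E : Fin m ≃ {e : Finset W // e ∈ F.edges})
    (φ : ∀ i : Fin m, {y : W // y ∈ (E i).1} ≃ Fin k),
    ∀ i j : Fin m, j < i →
      ∃ A ∈ I, ∀ y : {y : W // y ∈ (E i).1}, y.1 ∈ (E j).1 → φ i y ∈ A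

/-- `F` is `(𝓘, 𝓙)`-adapted. The label `k` is the last element of `Fin k` (the one with
value `k - 1`), and `[k-1]` is the initial segment `Fin (k - 1)` of `Fin k`. -/
def UniformHypergraph.IsAdaptedPair {W : Type*} {k : ℕ} (F : UniformHypergraph W k)
    (I : Finset (Finset (Fin k))) (J : Finset (Finset (Fin (k - 1)))) : Prop :=
  F.IsAdapted I ∧
  ∃ (x : W) (m : ℕ) (E : Fin m ≃ {e : Finset W // e ∈ F.edges})
    (ψ : ∀ i : Fin m, {y : W // y ∈ (E i).1} ≃ Fin k),
    ∀ i j : Fin m, j < i →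
      (x ∉ (E i).1 →
        ∃ A ∈ I, ∀ y : {y : W // y ∈ (E i).1}, y.1 ∈ (E j).1 → ψ i y ∈ A) ∧
      (∀ hx : x ∈ (E i).1,
        (ψ i ⟨x, hx⟩ : ℕ) + 1 = k ∧
        ∃ B ∈ J, ∀ y : {y : W // y ∈ (E i).1}, y.1 ∈ (E j).1 → y.1 ≠ x →
          ψ i y ∈ B.map (Fin.castLEEmb (Nat.sub_le k 1)))

/-! The proof is the absorbing method. Let `x` be the vertex of `F` singled out by adaptedness, and
let `v` be an injective tuple of vertices of `H` indexed by `W`, the vertex set of `F`. An absorber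
for `v` is a grid of vertices with rows indexed by `W` and columns by `W` without `x`. Every column
spans a copy of `F`, and every row does so once `v w` takes the place of `x`. Hence the columns tile
the grid alone, and the completed rows tile the grid together with `v`.

By `le_numSat_isAbsorber`, a fixed positive proportion of all grids absorbs any given `v`. So
`exists_pairwiseDisjoint_tuples` selects linearly many disjoint grids among which every `v` has at
least `ε n` absorbers. Outside them, copies of `F` are removed greedily, using
`exists_labeledCopy_mem`, until fewer than `ε n` vertices remain. Their number is divisible by the
order of `F`, and they are absorbed `card W` at a time, each batch by its own absorber
(`exists_absorbing_threshold`).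

Both counts impose the edges one by one in an adapted order. With all vertices outside the current
edge frozen, each earlier condition is either constant or depends only on the coordinates in one
member of `I`, or of `J` in the link of `v w` when the edge contains `x`. Discrepancy then keeps a
proportion `p`, or `α`, up to a small error (`OrderedDisc.numSat_and`). This needs discrepancy for
predicates on ordered tuples, whereas layouts consist of unordered sets; summing over all colourings
of the vertices by `[k]` bridges the gap (`UniformHypergraph.Disc.le_numSat_embedding`). -/

/-! ### Counting tuples: resampling coordinates and imposing conditions one at a time -/

section Counting

open Finset
open scoped Classical

/-- The number of elements of a finite type satisfying a predicate, as a real number. -/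
noncomputable def numSat {α : Type*} [Fintype α] (P : α → Prop) : ℝ :=
  ∑ a, if P a then 1 else 0

theorem numSat_eq_sum {α : Type*} [Fintype α] (P : α → Prop) [DecidablePred P] :
    numSat P = ∑ a, if P a then 1 else 0 := by
  rw [numSat]; congr!

theorem numSat_eq_card {α : Type*} [Fintype α] (P : α → Prop) [DecidablePred P] :
    numSat P = ((univ.filter P).card : ℝ) := by
  simp [numSat_eq_sum]

theorem numSat_eq_ncard {α : Type*} [Fintype α] (P : α → Prop) :
    numSat P = (({a | P a} : Set α).ncard : ℝ) := by
  rw [numSat_eq_card, ← Set.ncard_coe_finset]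
  simp

theorem numSat_nonneg {α : Type*} [Fintype α] (P : α → Prop) : 0 ≤ numSat P := by
  rw [numSat_eq_card]; positivity

theorem numSat_mono {α : Type*} [Fintype α] {P Q : α → Prop} (h : ∀ a, P a → Q a) :
    numSat P ≤ numSat Q := by
  rw [numSat_eq_card, numSat_eq_card]
  exact_mod_cast card_le_card (monotone_filter_right _ (fun a _ => h a))

theorem numSat_congr {α : Type*} [Fintype α] {P Q : α → Prop} (h : ∀ a, P a ↔ Q a) :
    numSat P = numSat Q := by
  rw [show P = Q from funext fun a => propext (h a)]

theorem numSat_true (α : Type*) [Fintype α] : numSat (fun _ : α => True) = Fintype.card α := by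
  simp [numSat]

theorem numSat_false (α : Type*) [Fintype α] : numSat (fun _ : α => False) = 0 := by
  simp [numSat]

theorem numSat_or_le {α : Type*} [Fintype α] (P Q : α → Prop) :
    numSat (fun a => P a ∨ Q a) ≤ numSat P + numSat Q := by
  simp only [numSat, ← sum_add_distrib]
  refine sum_le_sum fun a _ => ?_
  by_cases hP : P a <;> by_cases hQ : Q a <;> simp [hP, hQ]

theorem numSat_le_add {α : Type*} [Fintype α] {P Q R : α → Prop} (h : ∀ a, P a → Q a ∨ R a) :
    numSat P ≤ numSat Q + numSat R :=
  (numSat_mono h).trans (numSat_or_le Q R)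

theorem numSat_exists_le {α ι : Type*} [Fintype α] [Fintype ι] (P : ι → α → Prop) :
    numSat (fun a => ∃ i, P i a) ≤ ∑ i, numSat (P i) := by
  simp only [numSat]
  rw [sum_comm]
  refine sum_le_sum fun a _ => ?_
  by_cases h : ∃ i, P i a
  · obtain ⟨i, hi⟩ := h
    rw [if_pos ⟨i, hi⟩]
    calc (1 : ℝ) = if P i a then 1 else 0 := by rw [if_pos hi]
      _ ≤ _ := single_le_sum (f := fun i => if P i a then (1 : ℝ) else 0)
        (fun j _ => by split_ifs <;> norm_num) (mem_univ i)
  · rw [if_neg h]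
    exact sum_nonneg fun j _ => by split_ifs <;> norm_num

theorem numSat_equiv {α β : Type*} [Fintype α] [Fintype β] (e : α ≃ β) (P : β → Prop) :
    numSat (fun a => P (e a)) = numSat P :=
  Equiv.sum_comp e fun b => if P b then (1 : ℝ) else 0

theorem numSat_le_of_injective {α β : Type*} [Fintype α] [Fintype β] {P : α → Prop}
    {Q : β → Prop} (f : α → β) (hf : Function.Injective f) (h : ∀ a, P a → Q (f a)) :
    numSat P ≤ numSat Q := by
  rw [numSat_eq_card, numSat_eq_card]
  refine Nat.cast_le.2 (card_le_card_of_injOn f (fun a ha => ?_) hf.injOn)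
  simp only [coe_filter, mem_univ, true_and, Set.mem_ofPred_eq] at ha ⊢
  exact h a ha

theorem numSat_prod {α β : Type*} [Fintype α] [Fintype β] (P : α × β → Prop) :
    numSat P = ∑ a, numSat fun b => P (a, b) := by
  simp only [numSat]
  exact Fintype.sum_prod_type _

theorem numSat_prod_fst {α β : Type*} [Fintype α] [Fintype β] (P : α → Prop) :
    numSat (fun x : α × β => P x.1) = Fintype.card β * numSat P := by
  rw [numSat_prod, numSat, mul_sum]
  refine sum_congr rfl fun a _ => ?_
  by_cases h : P a <;> simp [numSat, h]

/-- Resampling the coordinates in the image of `e` preserves counts. -/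
theorem sum_numSat_extend {X V : Type*} [Fintype X] [DecidableEq X] [Fintype V] {r : ℕ} (e : Fin r ↪ X)
    (P : (X → V) → Prop) :
    ∑ g : X → V, numSat (fun y : Fin r → V => P (Function.extend e y g)) =
      (Fintype.card V : ℝ) ^ r * numSat P := by
  -- Exchanging `y` with the values of `g` along `e` is an involution on pairs; it turns the
  -- resampled condition into a condition on the first component alone.
  have hinv : Function.Involutive
      (fun x : (X → V) × (Fin r → V) => (Function.extend e x.2 x.1, x.1 ∘ e)) := by
    rintro ⟨g, y⟩
    refine Prod.ext ?_ ?_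
    · funext z
      by_cases hz : ∃ a, e a = z
      · obtain ⟨a, rfl⟩ := hz
        simp [e.injective.extend_apply]
      · simp [Function.extend_apply' _ _ _ hz]
    · funext a
      simp [e.injective.extend_apply]
  have h1 := numSat_equiv hinv.toPerm (fun x : (X → V) × (Fin r → V) => P x.1)
  rw [numSat_prod_fst, numSat_prod] at h1
  simpa using h1

/-- Resample the coordinate `z`: since `U g` ignores it, at most `u` of the new values are hits. -/
theorem card_mul_numSat_apply_mem_le {X V : Type*} [Fintype X] [DecidableEq X] [Fintype V] (z : X)
    (U : (X → V) → Finset V) (hU : ∀ g v, U (Function.update g z v) = U g) (u : ℕ)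
    (hu : ∀ g, (U g).card ≤ u) :
    (Fintype.card V : ℝ) * numSat (fun g : X → V => g z ∈ U g) ≤
      u * (Fintype.card V : ℝ) ^ Fintype.card X := by
  have hinv : Function.Involutive
      (fun x : (X → V) × V => (Function.update x.1 z x.2, x.1 z)) := by
    rintro ⟨g, y⟩
    simp
  have h1 := numSat_equiv hinv.toPerm (fun x : (X → V) × V => x.1 z ∈ U x.1)
  rw [numSat_prod_fst (fun g : X → V => g z ∈ U g), numSat_prod] at h1
  rw [← h1]
  calc _ ≤ ∑ _g : X → V, (u : ℝ) := by
        refine sum_le_sum fun g _ => ?_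
        simp only [Function.Involutive.coe_toPerm, Function.update_self, hU, numSat_eq_card]
        refine Nat.cast_le.2 (le_trans (card_le_card fun v hv => ?_) (hu g))
        simpa using hv
    _ = _ := by simp [mul_comm]

theorem card_mul_numSat_exists_mem_le {X V : Type*} [Fintype X] [DecidableEq X] [Fintype V] (U : Finset V) :
    (Fintype.card V : ℝ) * numSat (fun g : X → V => ∃ z, g z ∈ U) ≤
      Fintype.card X * U.card * (Fintype.card V : ℝ) ^ Fintype.card X := by
  calc _ ≤ (Fintype.card V : ℝ) * ∑ z : X, numSat (fun g : X → V => g z ∈ U) := by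
        gcongr
        exact numSat_exists_le fun (z : X) (g : X → V) => g z ∈ U
    _ = ∑ z : X, (Fintype.card V : ℝ) * numSat (fun g : X → V => g z ∈ U) := mul_sum ..
    _ ≤ ∑ _z : X, U.card * (Fintype.card V : ℝ) ^ Fintype.card X :=
        sum_le_sum fun z _ =>
          card_mul_numSat_apply_mem_le z (fun _ => U) (fun _ _ => rfl) _ fun _ => le_rfl
    _ = _ := by simp [mul_assoc]

theorem card_mul_numSat_not_injective_le (X V : Type*) [Fintype X] [DecidableEq X] [Fintype V] :
    (Fintype.card V : ℝ) * numSat (fun g : X → V => ¬ Function.Injective g) ≤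
      (Fintype.card X : ℝ) ^ 2 * (Fintype.card V : ℝ) ^ Fintype.card X := by
  calc _ ≤ (Fintype.card V : ℝ) *
          ∑ z : X × X, numSat (fun g : X → V => z.1 ≠ z.2 ∧ g z.1 = g z.2) := by
        gcongr
        refine le_trans (numSat_mono fun g hg => ?_)
          (numSat_exists_le fun (z : X × X) (g : X → V) => z.1 ≠ z.2 ∧ g z.1 = g z.2)
        simp only [Function.Injective, not_forall] at hg
        obtain ⟨a, b, hab, hne⟩ := hg
        exact ⟨(a, b), hne, hab⟩
    _ = ∑ z : X × X, (Fintype.card V : ℝ) *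
          numSat (fun g : X → V => z.1 ≠ z.2 ∧ g z.1 = g z.2) := mul_sum ..
    _ ≤ ∑ _z : X × X, (Fintype.card V : ℝ) ^ Fintype.card X := by
        refine sum_le_sum fun z _ => ?_
        by_cases hz : z.1 = z.2
        · simp only [hz, ne_eq, not_true_eq_false, false_and, numSat_false, mul_zero]
          positivity
        · have := card_mul_numSat_apply_mem_le (V := V) z.1 (fun g => {g z.2})
            (fun g v => by simp [Function.update_of_ne (Ne.symm hz)]) 1 (by simp)
          simpa [hz] using this
    _ = _ := by simp [sq]

/-- The discrepancy property for ordered tuples: the tuples singled out by predicates `Q A`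
depending only on the coordinates in `A`, for `A ∈ I`, satisfy `D` with density about `q`. -/
def OrderedDisc {V : Type*} [Fintype V] {r : ℕ} (I : Finset (Finset (Fin r))) (q ν : ℝ)
    (D : (Fin r → V) → Prop) : Prop :=
  ∀ Q : Finset (Fin r) → (Fin r → V) → Prop,
    (∀ A y y', (∀ a ∈ A, y a = y' a) → Q A y → Q A y') →
    q * numSat (fun y => ∀ A ∈ I, Q A y) - ν * (Fintype.card V : ℝ) ^ r ≤
      numSat (fun y => (∀ A ∈ I, Q A y) ∧ D y)

/-- Freeze the coordinates outside the image of `e`. Conditions whose support misses that image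
become constant, and the others can be grouped into one predicate per `A ∈ I`, so the discrepancy
property applies on each fibre. Summing over the frozen coordinates gives the bound. -/
theorem OrderedDisc.numSat_and {V X κ : Type*} [Fintype V] [Fintype X] [DecidableEq X] {r : ℕ}
    {I : Finset (Finset (Fin r))} {q ν : ℝ} {D : (Fin r → V) → Prop}
    (hD : OrderedDisc I q ν D) (hν : 0 ≤ ν) (hV : 0 < Fintype.card V) (e : Fin r ↪ X)
    (C : κ → (X → V) → Prop) (supp : κ → Set X)
    (hsupp : ∀ j g g', (∀ z ∈ supp j, g z = g' z) → C j g → C j g')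
    (h : ∀ j, (∀ a, e a ∉ supp j) ∨ ∃ A ∈ I, ∀ a, e a ∈ supp j → a ∈ A) :
    q * numSat (fun g => ∀ j, C j g) - ν * (Fintype.card V : ℝ) ^ Fintype.card X ≤
      numSat (fun g => (∀ j, C j g) ∧ D (g ∘ e)) := by
  have hpos : (0 : ℝ) < (Fintype.card V : ℝ) ^ r := by positivity
  have key : ∀ g : X → V,
      q * numSat (fun y : Fin r → V => ∀ j, C j (Function.extend e y g)) -
        ν * (Fintype.card V : ℝ) ^ r ≤
      numSat (fun y : Fin r → V => (∀ j, C j (Function.extend e y g)) ∧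
        D (Function.extend e y g ∘ e)) := by
    intro g
    have hext : ∀ y : Fin r → V, Function.extend e y g ∘ e = y := fun y => by
      funext a; simp [e.injective.extend_apply]
    by_cases hc : ∀ j, (∀ a, e a ∉ supp j) → C j g
    · have hQ := hD (fun A y => ∀ j, (∀ a, e a ∈ supp j → a ∈ A) → C j (Function.extend e y g))
        (fun A y y' hyy hC j hj => hsupp j _ _ (fun z hz => by
          by_cases hza : ∃ a, e a = z
          · obtain ⟨a, rfl⟩ := hza
            simp only [e.injective.extend_apply]
            exact hyy a (hj a hz)
          · simp only [Function.extend_apply' _ _ _ hza]) (hC j hj))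
      have hiff : ∀ y : Fin r → V, (∀ A ∈ I, ∀ j, (∀ a, e a ∈ supp j → a ∈ A) →
          C j (Function.extend e y g)) ↔ ∀ j, C j (Function.extend e y g) := by
        refine fun y => ⟨fun hA j => ?_, fun hC A _ j _ => hC j⟩
        rcases h j with hj | ⟨A, hAI, hj⟩
        · refine hsupp j g _ (fun z hz => ?_) (hc j hj)
          rw [Function.extend_apply']
          rintro ⟨a, rfl⟩
          exact hj a hz
        · exact hA A hAI j hj
      simpa only [hiff, hext] using hQ
    · push Not at hc
      obtain ⟨j, hj, hjC⟩ := hc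
      have hfalse : ∀ y : Fin r → V, ¬ ∀ j, C j (Function.extend e y g) := by
        refine fun y hy => hjC (hsupp j _ _ (fun z hz => ?_) (hy j))
        rw [Function.extend_apply']
        rintro ⟨a, rfl⟩
        exact hj a hz
      simp only [hfalse, false_and, numSat_false, mul_zero, zero_sub, Left.neg_nonpos_iff]
      positivity
  have hsum := sum_le_sum fun (g : X → V) (_ : g ∈ univ) => key g
  rw [sum_sub_distrib, ← mul_sum, sum_numSat_extend e (fun g => ∀ j, C j g),
    sum_numSat_extend e (fun g => (∀ j, C j g) ∧ D (g ∘ e))] at hsum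
  simp only [sum_const, card_univ, Fintype.card_fun, nsmul_eq_mul, Nat.cast_pow] at hsum
  refine le_of_mul_le_mul_left ?_ hpos
  linarith

/-- Conditions are imposed in order of increasing rank. Each keeps a proportion `q` up to `ν * N`,
and because `q ≤ 1` later steps do not amplify earlier errors, so these merely add up. -/
theorem le_numSat_forall_mem {Ω ι : Type*} [Fintype Ω] (rank : ι → ℕ) (P : Ω → Prop)
    (C : ι → Ω → Prop) {q ν N c : ℝ} (hq0 : 0 ≤ q) (hq1 : q ≤ 1) (hν : 0 ≤ ν) (hN : 0 ≤ N)
    (hP : c * N ≤ numSat P)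
    (hstep : ∀ (i : ι) (s : Finset ι), i ∉ s → (∀ j ∈ s, rank j ≤ rank i) →
      q * numSat (fun g => P g ∧ ∀ j ∈ s, C j g) - ν * N ≤
        numSat (fun g => (P g ∧ ∀ j ∈ s, C j g) ∧ C i g)) (s : Finset ι) :
    (q ^ s.card * c - s.card * ν) * N ≤ numSat (fun g => P g ∧ ∀ j ∈ s, C j g) := by
  induction s using Finset.induction_on_max_value rank with
  | empty => simpa using hP
  | insert i s hi hs ih =>
    have h1 := hstep i s hi hs
    have h2 : numSat (fun g => P g ∧ ∀ j ∈ insert i s, C j g) =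
        numSat (fun g => (P g ∧ ∀ j ∈ s, C j g) ∧ C i g) :=
      numSat_congr fun g => by simp only [forall_mem_insert]; tauto
    rw [h2, card_insert_of_notMem hi]
    refine le_trans ?_ h1
    have h3 := mul_le_mul_of_nonneg_left ih hq0
    have h4 : q * (s.card * ν) ≤ s.card * ν := mul_le_of_le_one_left (by positivity) hq1
    have h5 := mul_le_mul_of_nonneg_right h4 hN
    push_cast
    rw [pow_succ]
    linarith

end Counting

/-! ### From layouts of unordered sets to predicates on ordered tuples -/

section OrderedTuples

open Finset
open scoped Classical

theorem numSat_le_of_surj {α β : Type*} [Fintype α] [Fintype β] {P : α → Prop}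
    {Q : β → Prop} (f : β → α) (h : ∀ a, P a → ∃ b, Q b ∧ f b = a) :
    numSat P ≤ numSat Q := by
  rw [numSat_eq_card, numSat_eq_card]
  refine Nat.cast_le.2 (card_le_card_of_surjOn f fun a ha => ?_)
  obtain ⟨b, hb, rfl⟩ := h a (by simpa using ha)
  exact ⟨b, by simpa using hb, rfl⟩

section Coloring

variable {V : Type*} {k : ℕ}

/-- Tuples satisfying all predicates `Q A`, whose constrained coordinates have their own colour. -/
def IsColoredTuple (I : Finset (Finset (Fin k))) (Q : Finset (Fin k) → (Fin k → V) → Prop)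
    (c : V → Fin k) (x : Fin k ↪ V) : Prop :=
  (∀ A ∈ I, ∀ a ∈ A, c (x a) = a) ∧ ∀ A ∈ I, Q A x

/-- The layout encoding the ordered predicates `Q A` by means of a colouring. -/
def colorLayout (I : Finset (Finset (Fin k))) (Q : Finset (Fin k) → (Fin k → V) → Prop)
    (c : V → Fin k) : Layout I V := fun A =>
  { edges := {S | ∃ y : Fin k ↪ V, S = A.1.map y ∧ (∀ a ∈ A.1, c (y a) = a) ∧ Q A.1 y}
    uniform := by
      rintro _ ⟨y, rfl, -⟩
      exact card_map _ }

/-- The permutations preserving every member of `I` and fixing all points outside `⋃ I`. -/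
noncomputable def layoutPerms (I : Finset (Finset (Fin k))) : Finset (Equiv.Perm (Fin k)) :=
  univ.filter fun σ => (∀ a, (∀ A ∈ I, a ∉ A) → σ a = a) ∧ ∀ A ∈ I, ∀ a, σ a ∈ A ↔ a ∈ A

theorem mem_layoutPerms {I : Finset (Finset (Fin k))} {σ : Equiv.Perm (Fin k)} :
    σ ∈ layoutPerms I ↔
      (∀ a, (∀ A ∈ I, a ∉ A) → σ a = a) ∧ ∀ A ∈ I, ∀ a, σ a ∈ A ↔ a ∈ A := by
  simp [layoutPerms]

theorem IsColoredTuple.color_eq {I : Finset (Finset (Fin k))}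
    {Q : Finset (Fin k) → (Fin k → V) → Prop} {c : V → Fin k} {x : Fin k ↪ V}
    {σ : Equiv.Perm (Fin k)} (hσ : σ ∈ layoutPerms I)
    (h : IsColoredTuple I Q c (σ.symm.toEmbedding.trans x)) {A : Finset (Fin k)} (hA : A ∈ I)
    {a : Fin k} (ha : a ∈ A) : c (x a) = σ a := by
  have := h.1 A hA (σ a) (((mem_layoutPerms.1 hσ).2 A hA a).2 ha)
  simpa using this

/-- On the union of `I` the colours of the entries of `x` determine the permutation; elsewhere it is
the identity. -/
theorem IsColoredTuple.perm_unique {I : Finset (Finset (Fin k))}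
    {Q : Finset (Fin k) → (Fin k → V) → Prop} {c : V → Fin k} {x : Fin k ↪ V}
    {σ τ : Equiv.Perm (Fin k)} (hσ : σ ∈ layoutPerms I) (hτ : τ ∈ layoutPerms I)
    (h : IsColoredTuple I Q c (σ.symm.toEmbedding.trans x))
    (h' : IsColoredTuple I Q c (τ.symm.toEmbedding.trans x)) : σ = τ := by
  ext a : 1
  by_cases ha : ∃ A ∈ I, a ∈ A
  · obtain ⟨A, hA, haA⟩ := ha
    rw [← h.color_eq hσ hA haA, ← h'.color_eq hτ hA haA]
  · push Not at ha
    rw [(mem_layoutPerms.1 hσ).1 a ha, (mem_layoutPerms.1 hτ).1 a ha]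

/-- In a clique the map sending `a` to the colour of `x a` permutes every member of `I`. Extended by
the identity it is a permutation of `Fin k`, and reordering `x` by it puts every constrained entry
at the coordinate named by its colour. -/
theorem mem_cliques_colorLayout {I : Finset (Finset (Fin k))}
    {Q : Finset (Fin k) → (Fin k → V) → Prop}
    (hQ : ∀ A y y', (∀ a ∈ A, y a = y' a) → Q A y → Q A y') {c : V → Fin k} {x : Fin k ↪ V} :
    x ∈ (colorLayout I Q c).cliques ↔
      ∃ σ ∈ layoutPerms I, IsColoredTuple I Q c (σ.symm.toEmbedding.trans x) := by
  constructor
  · intro hx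
    have hx' : ∀ A ∈ I, ∃ y : Fin k ↪ V, A.map x = A.map y ∧ (∀ a ∈ A, c (y a) = a) ∧ Q A y :=
      fun A hA => hx ⟨A, hA⟩
    have hcmem : ∀ A ∈ I, ∀ a ∈ A, c (x a) ∈ A ∧ ∀ y : Fin k ↪ V, A.map x = A.map y →
        (∀ a ∈ A, c (y a) = a) → y (c (x a)) = x a := by
      have hy : ∀ A ∈ I, ∀ a ∈ A, ∀ y : Fin k ↪ V, A.map x = A.map y →
        (∀ a ∈ A, c (y a) = a) → c (x a) ∈ A ∧ y (c (x a)) = x a := by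
        intro A hA a ha y hy1 hy2
        have : x a ∈ A.map y := hy1 ▸ mem_map_of_mem x ha
        obtain ⟨b, hb, hbx⟩ := mem_map.1 this
        rw [← hbx, hy2 b hb]
        exact ⟨hb, rfl⟩
      intro A hA a ha
      obtain ⟨y, hy1, hy2, -⟩ := hx' A hA
      exact ⟨(hy A hA a ha y hy1 hy2).1, fun y hy1 hy2 => (hy A hA a ha y hy1 hy2).2⟩
    have hinjA : ∀ A ∈ I, ∀ a ∈ A, ∀ b ∈ A, c (x a) = c (x b) → a = b := by
      intro A hA a ha b hb hab
      obtain ⟨y, hy1, hy2, -⟩ := hx' A hA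
      apply x.injective
      rw [← (hcmem A hA a ha).2 y hy1 hy2, ← (hcmem A hA b hb).2 y hy1 hy2, hab]
    -- The colour map sends `A ∩ B` injectively into itself, hence onto itself; injectivity on `A`
    -- then places `a` in `B`. This is what makes the map injective across different members of `I`.
    have hmemiff : ∀ A ∈ I, ∀ B ∈ I, ∀ a ∈ A, c (x a) ∈ B → a ∈ B := by
      intro A hA B hB a ha hcB
      have himg : (A ∩ B).image (fun a => c (x a)) = A ∩ B := by
        refine eq_of_subset_of_card_le ?_ ?_
        · intro b hb
          obtain ⟨a', ha', rfl⟩ := mem_image.1 hb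
          rw [mem_inter] at ha' ⊢
          exact ⟨(hcmem A hA a' ha'.1).1, (hcmem B hB a' ha'.2).1⟩
        · rw [card_image_of_injOn]
          intro a' ha' b' hb' h
          exact hinjA A hA a' (mem_inter.1 ha').1 b' (mem_inter.1 hb').1 h
      have : c (x a) ∈ (A ∩ B).image (fun a => c (x a)) := by
        rw [himg]
        exact mem_inter.2 ⟨(hcmem A hA a ha).1, hcB⟩
      obtain ⟨a', ha', h⟩ := mem_image.1 this
      rw [← hinjA A hA a' (mem_inter.1 ha').1 a ha h]
      exact (mem_inter.1 ha').2
    let f : Fin k → Fin k := fun a => if ∃ A ∈ I, a ∈ A then c (x a) else a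
    have hf1 : ∀ A ∈ I, ∀ a ∈ A, f a = c (x a) := fun A hA a ha => if_pos ⟨A, hA, ha⟩
    have hf2 : ∀ a, (∀ A ∈ I, a ∉ A) → f a = a := fun a ha => if_neg (by push Not; exact ha)
    have hfinj : Function.Injective f := by
      intro a b hab
      by_cases ha : ∃ A ∈ I, a ∈ A
      · obtain ⟨A, hA, haA⟩ := ha
        have hmem := (hcmem A hA a haA).1
        rw [← hf1 A hA a haA, hab] at hmem
        by_cases hb : ∃ B ∈ I, b ∈ B
        · obtain ⟨B, hB, hbB⟩ := hb
          rw [hf1 B hB b hbB] at hmem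
          have hbA := hmemiff B hB A hA b hbB hmem
          rw [hf1 A hA a haA, hf1 A hA b hbA] at hab
          exact hinjA A hA a haA b hbA hab
        · push Not at hb
          rw [hf2 b hb] at hmem
          exact absurd hmem (hb A hA)
      · push Not at ha
        rw [hf2 a ha] at hab
        by_cases hb : ∃ B ∈ I, b ∈ B
        · obtain ⟨B, hB, hbB⟩ := hb
          rw [hf1 B hB b hbB] at hab
          exact absurd (hab ▸ (hcmem B hB b hbB).1) (ha B hB)
        · push Not at hb
          rw [hf2 b hb] at hab
          exact hab
    let σ : Equiv.Perm (Fin k) := Equiv.ofBijective f (Finite.injective_iff_bijective.1 hfinj)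
    have hσmem : ∀ A ∈ I, ∀ a, σ a ∈ A ↔ a ∈ A := by
      intro A hA a
      change f a ∈ A ↔ a ∈ A
      constructor
      · intro h
        by_cases hb : ∃ B ∈ I, a ∈ B
        · obtain ⟨B, hB, hbB⟩ := hb
          rw [hf1 B hB a hbB] at h
          exact hmemiff B hB A hA a hbB h
        · push Not at hb
          rwa [hf2 a hb] at h
      · intro h
        rw [hf1 A hA a h]
        exact (hcmem A hA a h).1
    have hσc : ∀ A ∈ I, ∀ a ∈ A, c (x (σ.symm a)) = a := by
      intro A hA a ha
      have h1 : σ.symm a ∈ A := by rw [← hσmem A hA]; simpa using ha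
      rw [← hf1 A hA _ h1]
      exact σ.apply_symm_apply a
    refine ⟨σ, mem_layoutPerms.2 ⟨hf2, hσmem⟩, hσc, fun A hA => ?_⟩
    obtain ⟨y, hy1, hy2, hy3⟩ := hx' A hA
    refine hQ A y _ (fun a ha => ?_) hy3
    have h1 : σ.symm a ∈ A := by rw [← hσmem A hA]; simpa using ha
    have h2 := (hcmem A hA _ h1).2 y hy1 hy2
    rw [hσc A hA a ha] at h2
    exact h2
  · rintro ⟨σ, hσ, hx⟩ A
    refine ⟨σ.symm.toEmbedding.trans x, ?_, hx.1 A.1 A.2, hx.2 A.1 A.2⟩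
    have hmap : A.1.map σ.symm.toEmbedding = A.1 := by
      ext a
      rw [mem_map_equiv]
      simpa using (mem_layoutPerms.1 hσ).2 A.1 A.2 a
    rw [← map_map, hmap]

/-- Each clique is a reordering of a coloured tuple by exactly one permutation in `layoutPerms I`,
and `Z` is invariant under reordering. -/
theorem numSat_cliques_colorLayout [Fintype V] {I : Finset (Finset (Fin k))}
    {Q : Finset (Fin k) → (Fin k → V) → Prop}
    (hQ : ∀ A y y', (∀ a ∈ A, y a = y' a) → Q A y → Q A y') (c : V → Fin k)
    (Z : (Fin k ↪ V) → Prop) (hZ : ∀ (σ : Equiv.Perm (Fin k)) x, Z (σ.toEmbedding.trans x) ↔ Z x) :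
    numSat (fun x => x ∈ (colorLayout I Q c).cliques ∧ Z x) =
      (layoutPerms I).card * numSat (fun x => IsColoredTuple I Q c x ∧ Z x) := by
  have h1 : ∀ σ : Equiv.Perm (Fin k),
      numSat (fun x : Fin k ↪ V => IsColoredTuple I Q c (σ.symm.toEmbedding.trans x) ∧ Z x) =
        numSat (fun x => IsColoredTuple I Q c x ∧ Z x) := by
    intro σ
    have := numSat_equiv (Equiv.embeddingCongr σ (Equiv.refl V))
      (fun x : Fin k ↪ V => IsColoredTuple I Q c x ∧ Z x)
    rw [← this]
    refine numSat_congr fun x => ?_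
    have hx : (Equiv.embeddingCongr σ (Equiv.refl V)) x = σ.symm.toEmbedding.trans x := by
      ext a; simp
    rw [hx, hZ]
  calc _ = ∑ x : Fin k ↪ V, ∑ σ ∈ layoutPerms I,
        if IsColoredTuple I Q c (σ.symm.toEmbedding.trans x) ∧ Z x then (1 : ℝ) else 0 := by
        refine sum_congr rfl fun x _ => ?_
        by_cases hx : x ∈ (colorLayout I Q c).cliques ∧ Z x
        · rw [if_pos hx]
          obtain ⟨σ, hσ, hxσ⟩ := (mem_cliques_colorLayout hQ).1 hx.1
          rw [sum_eq_single_of_mem σ hσ, if_pos ⟨hxσ, hx.2⟩]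
          intro τ hτ hne
          exact if_neg fun h => hne (IsColoredTuple.perm_unique hτ hσ h.1 hxσ)
        · rw [if_neg hx, sum_eq_zero]
          intro σ hσ
          exact if_neg fun h => hx ⟨(mem_cliques_colorLayout hQ).2 ⟨σ, hσ, h.1⟩, h.2⟩
    _ = ∑ σ ∈ layoutPerms I, numSat
          (fun x : Fin k ↪ V => IsColoredTuple I Q c (σ.symm.toEmbedding.trans x) ∧ Z x) := by
        rw [sum_comm]
        exact sum_congr rfl fun σ _ => (numSat_eq_sum _).symm
    _ = _ := by simp [h1]

/-- The number `N` of colourings that give the constrained entries of `x` their own colours does not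
depend on `x`. At most `k` vertices have a prescribed colour, whence the lower bound on `N`. -/
theorem exists_sum_numSat_isColoredTuple (V : Type*) [Fintype V] (hk : 0 < k)
    (I : Finset (Finset (Fin k))) :
    ∃ N : ℝ, 0 < N ∧ (k : ℝ) ^ Fintype.card V ≤ N * (k : ℝ) ^ k ∧
      ∀ (Q : Finset (Fin k) → (Fin k → V) → Prop) (Z : (Fin k ↪ V) → Prop),
        ∑ c : V → Fin k, numSat (fun x => IsColoredTuple I Q c x ∧ Z x) =
          N * numSat (fun x : Fin k ↪ V => (∀ A ∈ I, Q A x) ∧ Z x) := by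
  set M : ℝ := numSat fun y : Fin k → Fin k => ∀ A ∈ I, ∀ a ∈ A, y a = a with hM
  have hk' : (0 : ℝ) < k := by exact_mod_cast hk
  have hM1 : 1 ≤ M := by
    rw [hM, numSat_eq_card]
    exact_mod_cast card_pos.2 ⟨id, by simp⟩
  have hcount : ∀ x : Fin k ↪ V, (k : ℝ) ^ Fintype.card V * M =
      (k : ℝ) ^ k * numSat fun c : V → Fin k => ∀ A ∈ I, ∀ a ∈ A, c (x a) = a := by
    intro x
    have := sum_numSat_extend (V := Fin k) x (fun c => ∀ A ∈ I, ∀ a ∈ A, c (x a) = a)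
    simp only [x.injective.extend_apply] at this
    simpa [← hM] using this
  refine ⟨(k : ℝ) ^ Fintype.card V * M / (k : ℝ) ^ k, by positivity, ?_, fun Q Z => ?_⟩
  · rw [div_mul_cancel₀ _ (by positivity)]
    exact le_mul_of_one_le_right (by positivity) hM1
  · simp only [numSat]
    rw [sum_comm, mul_sum]
    refine sum_congr rfl fun x _ => ?_
    rw [hcount x, mul_div_cancel_left₀ _ (by positivity)]
    by_cases hx : (∀ A ∈ I, Q A x) ∧ Z x
    · rw [if_pos hx, mul_one]
      refine sum_congr rfl fun c _ => ?_
      by_cases hc : ∀ A ∈ I, ∀ a ∈ A, c (x a) = a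
      · rw [if_pos hc, if_pos ⟨⟨hc, hx.1⟩, hx.2⟩]
      · rw [if_neg hc, if_neg fun h => hc h.1.1]
    · rw [if_neg hx, mul_zero]
      exact sum_eq_zero fun c _ => if_neg fun h => hx ⟨h.1.2, h.2⟩

/-- Sum the discrepancy inequality of `colorLayout` over all `c`. The main terms are all multiplied
by the same factor, at least `N`, while the `k ^ card V` error terms outweigh `N` by at most `k ^
k`. -/
theorem UniformHypergraph.Disc.le_numSat_embedding [Fintype V] {H : UniformHypergraph V k}
    {I : Finset (Finset (Fin k))} {p μ : ℝ} (h : H.Disc I p μ) (hk : 0 < k) (hμ : 0 ≤ μ)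
    {Q : Finset (Fin k) → (Fin k → V) → Prop}
    (hQ : ∀ A y y', (∀ a ∈ A, y a = y' a) → Q A y → Q A y') :
    p * numSat (fun x : Fin k ↪ V => ∀ A ∈ I, Q A x) -
        μ * (k : ℝ) ^ k * (Fintype.card V : ℝ) ^ k ≤
      numSat (fun x : Fin k ↪ V => (∀ A ∈ I, Q A x) ∧ univ.map x ∈ H.edges) := by
  obtain ⟨N, hN, hNk, hsum⟩ := exists_sum_numSat_isColoredTuple V hk I
  have hG : (1 : ℝ) ≤ (layoutPerms I).card := by
    exact_mod_cast card_pos.2 ⟨1, mem_layoutPerms.2 (by simp)⟩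
  have hc : ∀ c : V → Fin k,
      p * ((layoutPerms I).card * numSat (fun x => IsColoredTuple I Q c x ∧ True)) -
        μ * (Fintype.card V : ℝ) ^ k ≤
      (layoutPerms I).card *
        numSat (fun x => IsColoredTuple I Q c x ∧ univ.map x ∈ H.edges) := by
    intro c
    have := h (colorLayout I Q c)
    rw [← numSat_cliques_colorLayout hQ c (fun _ => True) (by simp),
      ← numSat_cliques_colorLayout hQ c (fun x => univ.map x ∈ H.edges), numSat_eq_ncard,
      numSat_eq_ncard]
    · simpa using this
    · intro σ x
      rw [← map_map, map_univ_equiv]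
  have := sum_le_sum fun c (_ : c ∈ univ) => hc c
  rw [sum_sub_distrib] at this
  simp only [← mul_sum, hsum, sum_const, card_univ, Fintype.card_fun, Fintype.card_fin, nsmul_eq_mul,
    Nat.cast_pow] at this
  have htrue : numSat (fun x : Fin k ↪ V => (∀ A ∈ I, Q A x) ∧ True) =
      numSat (fun x : Fin k ↪ V => ∀ A ∈ I, Q A x) := numSat_congr fun x => by simp
  rw [htrue] at this
  have hpos : 0 < (layoutPerms I).card * N := by positivity
  refine le_of_mul_le_mul_left ?_ hpos
  have h2 : (k : ℝ) ^ Fintype.card V * (μ * (Fintype.card V : ℝ) ^ k) ≤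
      (layoutPerms I).card * N * (μ * (k : ℝ) ^ k * (Fintype.card V : ℝ) ^ k) := by
    calc _ ≤ (N * (k : ℝ) ^ k) * (μ * (Fintype.card V : ℝ) ^ k) := by gcongr
      _ ≤ (layoutPerms I).card * ((N * (k : ℝ) ^ k) * (μ * (Fintype.card V : ℝ) ^ k)) :=
          le_mul_of_one_le_left (by positivity) hG
      _ = _ := by ring
  linarith

end Coloring

/-- Tuples that do not come from injective tuples in `V'` are charged to the error `K`. The two
vertex types allow one argument to serve both `H` and its links, whose vertex sets omit a vertex. -/
theorem UniformHypergraph.Disc.orderedDisc_of_embedding {V V' : Type*} [Fintype V] [Fintype V']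
    {r : ℕ} {H : UniformHypergraph V' r} {I : Finset (Finset (Fin r))} {q μ K : ℝ}
    (h : H.Disc I q μ) (hr : 0 < r) (hμ : 0 ≤ μ) (hq0 : 0 ≤ q) (hq1 : q ≤ 1) (i : V' ↪ V)
    (hK : numSat (fun y : Fin r → V => ¬ ∃ x : Fin r ↪ V', ∀ a, i (x a) = y a) ≤
      K * (Fintype.card V : ℝ) ^ r) {D : (Fin r → V) → Prop}
    (hD : ∀ x : Fin r ↪ V', univ.map x ∈ H.edges → D (fun a => i (x a))) :
    OrderedDisc I q (μ * (r : ℝ) ^ r + K) D := by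
  intro Q hQ
  have h1 := h.le_numSat_embedding hr hμ (Q := fun A x => Q A (fun a => i (x a)))
    (fun A y y' hy => hQ A _ _ fun a ha => by rw [hy a ha])
  have h2 : numSat (fun y : Fin r → V => ∀ A ∈ I, Q A y) ≤
      numSat (fun x : Fin r ↪ V' => ∀ A ∈ I, Q A (fun a => i (x a))) +
        K * (Fintype.card V : ℝ) ^ r := by
    refine le_trans (numSat_le_add (Q := fun y : Fin r → V => (∀ A ∈ I, Q A y) ∧
      ∃ x : Fin r ↪ V', ∀ a, i (x a) = y a) fun y hy => ?_) (add_le_add ?_ hK)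
    · by_cases hx : ∃ x : Fin r ↪ V', ∀ a, i (x a) = y a
      · exact Or.inl ⟨hy, hx⟩
      · exact Or.inr hx
    · refine numSat_le_of_surj (fun (x : Fin r ↪ V') a => i (x a)) ?_
      rintro y ⟨hy, x, hx⟩
      obtain rfl : (fun a => i (x a)) = y := funext hx
      exact ⟨x, hy, rfl⟩
  have h3 : numSat (fun x : Fin r ↪ V' => (∀ A ∈ I, Q A (fun a => i (x a))) ∧
      univ.map x ∈ H.edges) ≤ numSat (fun y : Fin r → V => (∀ A ∈ I, Q A y) ∧ D y) := by
    have hinj : Function.Injective fun (x : Fin r ↪ V') (a : Fin r) => i (x a) := by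
      intro x x' hxx
      ext a
      exact i.injective (congrFun hxx a)
    exact numSat_le_of_injective _ hinj fun x hx => ⟨hx.1, hD x hx.2⟩
  have hK0 : 0 ≤ K * (Fintype.card V : ℝ) ^ r := (numSat_nonneg _).trans hK
  have h4 : (Fintype.card V' : ℝ) ^ r ≤ (Fintype.card V : ℝ) ^ r := by
    gcongr
    exact Fintype.card_le_of_embedding i
  have h5 := mul_le_mul_of_nonneg_left h2 hq0
  have h6 : q * (K * (Fintype.card V : ℝ) ^ r) ≤ K * (Fintype.card V : ℝ) ^ r :=
    mul_le_of_le_one_left hK0 hq1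
  have h7 := mul_le_mul_of_nonneg_left h4 (a := μ * (r : ℝ) ^ r) (by positivity)
  linarith

theorem UniformHypergraph.Disc.orderedDisc {V : Type*} [Fintype V] {k : ℕ}
    {H : UniformHypergraph V k} {I : Finset (Finset (Fin k))} {q μ : ℝ}
    (h : H.Disc I q μ) (hk : 0 < k) (hμ : 0 ≤ μ) (hq0 : 0 ≤ q) (hq1 : q ≤ 1)
    (hV : 0 < Fintype.card V) :
    OrderedDisc I q (μ * (k : ℝ) ^ k + (k : ℝ) ^ 2 / Fintype.card V)
      (fun y => univ.image y ∈ H.edges) := by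
  refine h.orderedDisc_of_embedding hk hμ hq0 hq1 (Function.Embedding.refl V) ?_ fun x hx => ?_
  · have hV' : (0 : ℝ) < Fintype.card V := by exact_mod_cast hV
    rw [div_mul_eq_mul_div, le_div_iff₀ hV', mul_comm]
    refine le_trans (mul_le_mul_of_nonneg_left (numSat_mono fun y hy => ?_) hV'.le) <|
      (card_mul_numSat_not_injective_le (Fin k) V).trans (by simp)
    exact fun hinj => hy ⟨⟨y, hinj⟩, fun a => rfl⟩
  · rw [map_eq_image] at hx
    exact hx

theorem UniformHypergraph.Disc.orderedDisc_link {V : Type*} [Fintype V] {k : ℕ}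
    {H : UniformHypergraph V k} {v : V} {J : Finset (Finset (Fin (k - 1)))} {q μ : ℝ}
    (h : (H.link v).Disc J q μ) (hk : 2 ≤ k) (hμ : 0 ≤ μ) (hq0 : 0 ≤ q) (hq1 : q ≤ 1) :
    OrderedDisc J q (μ * (k : ℝ) ^ k + (k : ℝ) ^ 2 / Fintype.card V)
      (fun y => insert v (univ.image y) ∈ H.edges) := by
  have hV' : (0 : ℝ) < Fintype.card V := by exact_mod_cast Fintype.card_pos_iff.2 ⟨v⟩
  have hk1 : ((k - 1 : ℕ) : ℝ) = k - 1 := by push_cast [Nat.cast_sub (by omega : 1 ≤ k)]; ring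
  have hk2 : (2 : ℝ) ≤ k := by exact_mod_cast hk
  have h1 := h.orderedDisc_of_embedding (V := V) (K := (k : ℝ) ^ 2 / Fintype.card V)
    (D := fun y => insert v (univ.image y) ∈ H.edges) (by omega) hμ hq0 hq1
    (Function.Embedding.subtype _) ?_ fun x hx => ?_
  · intro Q hQ
    refine le_trans ?_ (h1 Q hQ)
    -- Deliberately wasteful, so that `H` and all links share one error term.
    have : ((k - 1 : ℕ) : ℝ) ^ (k - 1) ≤ (k : ℝ) ^ k := by
      calc ((k - 1 : ℕ) : ℝ) ^ (k - 1) ≤ (k : ℝ) ^ (k - 1) := by gcongr; omega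
        _ ≤ _ := pow_le_pow_right₀ (by linarith) (by omega)
    gcongr
  · rw [div_mul_eq_mul_div, le_div_iff₀ hV', mul_comm]
    have h2 := card_mul_numSat_not_injective_le (Fin (k - 1)) V
    have h3 := card_mul_numSat_exists_mem_le (X := Fin (k - 1)) ({v} : Finset V)
    have h4 : numSat (fun y : Fin (k - 1) → V => ¬ ∃ x : Fin (k - 1) ↪ {w : V // w ≠ v},
        ∀ a, Function.Embedding.subtype _ (x a) = y a) ≤
        numSat (fun g : Fin (k - 1) → V => ¬ Function.Injective g) +
        numSat (fun g : Fin (k - 1) → V => ∃ z, g z ∈ ({v} : Finset V)) := by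
      refine numSat_le_add fun y hy => ?_
      by_contra! hcon
      obtain ⟨hinj, hne⟩ := hcon
      simp only [mem_singleton] at hne
      exact hy ⟨⟨fun a => ⟨y a, hne a⟩, fun a b hab => hinj (congrArg Subtype.val hab)⟩,
        fun a => rfl⟩
    have h5 := mul_le_mul_of_nonneg_left h4 hV'.le
    simp only [Fintype.card_fin, card_singleton, hk1, Nat.cast_one] at h2 h3
    have h6 : (((k : ℝ) - 1) ^ 2 + (k - 1) * 1) * (Fintype.card V : ℝ) ^ (k - 1) ≤
        (k : ℝ) ^ 2 * (Fintype.card V : ℝ) ^ (k - 1) := by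
      gcongr
      nlinarith
    calc _ ≤ _ := h5
      _ ≤ (((k : ℝ) - 1) ^ 2 + (k - 1) * 1) * (Fintype.card V : ℝ) ^ (k - 1) := by linarith
      _ ≤ _ := h6
  · have : Finset.cons v ((univ.map x).map (Function.Embedding.subtype fun y : V => y ≠ v))
        (by simp [(x _).2]) ∈ H.edges := hx
    rw [cons_eq_insert, map_map, map_eq_image] at this
    exact this

end OrderedTuples

/-! ### Counting copies of `F` and absorbers -/

section Embedding

open Finset
open scoped Classical

theorem image_comp_equiv_symm {W V : Type*} {k : ℕ} {e : Finset W}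
    (φ : {y : W // y ∈ e} ≃ Fin k) (g : W → V) :
    univ.image (fun a => g (φ.symm a).1) = e.image g := by
  ext v
  simp only [mem_image, mem_univ, true_and]
  constructor
  · rintro ⟨a, rfl⟩
    exact ⟨_, (φ.symm a).2, rfl⟩
  · rintro ⟨y, hy, rfl⟩
    exact ⟨φ ⟨y, hy⟩, by simp⟩

theorem numSat_forall_mem (X : Type*) {V : Type*} [Fintype X] [DecidableEq X] [Fintype V]
    (S : Finset V) :
    numSat (fun g : X → V => ∀ z, g z ∈ S) = (S.card : ℝ) ^ Fintype.card X := by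
  rw [numSat_eq_card]
  have : (univ.filter fun g : X → V => ∀ z, g z ∈ S).card = (Fintype.piFinset fun _ => S).card :=
    congrArg card (by ext g; simp)
  simp only [Fintype.card_piFinset, prod_const, card_univ] at this
  rw [← Nat.cast_pow, ← this]

/-- The counting lemma: large sets of vertices contain copies of an adapted `k`-graph. -/
theorem exists_labeledCopy_mem {W V : Type*} [Fintype W] [Fintype V] {k m : ℕ}
    {F : UniformHypergraph W k} {H : UniformHypergraph V k} {I : Finset (Finset (Fin k))}
    (hcov : ∀ a : Fin k, ∃ A ∈ I, a ∈ A) (E : Fin m ≃ {e : Finset W // e ∈ F.edges})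
    (φ : ∀ i : Fin m, {y : W // y ∈ (E i).1} ≃ Fin k)
    (hφ : ∀ i j : Fin m, j < i →
      ∃ A ∈ I, ∀ y : {y : W // y ∈ (E i).1}, y.1 ∈ (E j).1 → φ i y ∈ A)
    {p ν ε : ℝ} (hp0 : 0 ≤ p) (hp1 : p ≤ 1) (hν : 0 ≤ ν) (hε : 0 ≤ ε)
    (hD : OrderedDisc I p ν (fun y : Fin k → V => univ.image y ∈ H.edges))
    (hV : 0 < Fintype.card V) {S : Finset V} (hS : ε * Fintype.card V ≤ S.card)
    (hlarge : m * ν + (Fintype.card W : ℝ) ^ 2 / Fintype.card V <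
      p ^ m * ε ^ Fintype.card W) :
    ∃ q : W ↪ V, F.IsLabeledCopy H q ∧ ∀ w, q w ∈ S := by
  have hV' : (0 : ℝ) < Fintype.card V := by exact_mod_cast hV
  set N : ℝ := (Fintype.card V : ℝ) ^ Fintype.card W with hN
  have hN0 : 0 < N := by positivity
  have hcount := le_numSat_forall_mem (Ω := W → V) (ι := Fin m) (fun i => (i : ℕ))
    (fun g => ∀ w, g w ∈ S) (fun i g => (E i).1.image g ∈ H.edges) (N := N)
    (c := ε ^ Fintype.card W) hp0 hp1 hν hN0.le ?_ ?_ univ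
  · rw [card_univ, Fintype.card_fin] at hcount
    have hni := card_mul_numSat_not_injective_le W V
    rw [← hN, ← le_div_iff₀' hV'] at hni
    have hlt : numSat (fun g : W → V => ¬ Function.Injective g) <
        numSat (fun g : W → V => (∀ w, g w ∈ S) ∧
          ∀ j ∈ (univ : Finset (Fin m)), (E j).1.image g ∈ H.edges) := by
      refine lt_of_le_of_lt hni (lt_of_lt_of_le ?_ hcount)
      rw [mul_div_right_comm]
      gcongr
      linarith
    by_contra! hcon
    refine hlt.not_ge (numSat_mono fun g hg hinj => ?_)
    obtain ⟨w, hw⟩ := hcon ⟨g, hinj⟩ fun e he => by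
      have := hg.2 (E.symm ⟨e, he⟩) (mem_univ _)
      rw [map_eq_image]
      simpa using this
    exact hw (hg.1 w)
  · rw [numSat_forall_mem, hN, ← mul_pow]
    gcongr
  · intro i s his hs
    have hstep := hD.numSat_and hν hV
      ⟨fun a => ((φ i).symm a).1, fun a b hab => (φ i).symm.injective (Subtype.ext hab)⟩
      (κ := W ⊕ {j // j ∈ s})
      (Sum.elim (fun w g => g w ∈ S) fun j g => (E j.1).1.image g ∈ H.edges)
      (Sum.elim (fun w => {w}) fun j => ((E j.1).1 : Set W)) ?_ ?_
    · refine le_trans (le_of_eq ?_) (hstep.trans (le_of_eq ?_))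
      · congr 2
        exact numSat_congr fun g => by simp
      · refine numSat_congr fun g => ?_
        have := image_comp_equiv_symm (φ i) g
        simp only [Sum.forall, Sum.elim_inl, Sum.elim_inr, Subtype.forall]
        rw [← this]
        rfl
    · rintro (w | j) g g' hgg hC
      · have := hgg w rfl
        simpa [this] using hC
      · simp only [Sum.elim_inr] at hC hgg ⊢
        rwa [← image_congr (f := g) (g := g') fun z hz => hgg z hz]
    · rintro (w | j)
      -- Lying in `S` constrains a single coordinate, and `I` covers every coordinate.
      · by_cases hw : w ∈ (E i).1
        · obtain ⟨A, hA, hwA⟩ := hcov (φ i ⟨w, hw⟩)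
          refine Or.inr ⟨A, hA, fun a ha => ?_⟩
          have ha' : ((φ i).symm a).1 = w := ha
          have : (φ i).symm a = ⟨w, hw⟩ := Subtype.ext ha'
          rwa [← this, Equiv.apply_symm_apply] at hwA
        · refine Or.inl fun a ha => hw ?_
          have ha' : ((φ i).symm a).1 = w := ha
          exact ha' ▸ ((φ i).symm a).2
      · have hji : j.1 < i := lt_of_le_of_ne (hs j.1 j.2) fun h => his (h ▸ j.2)
        obtain ⟨A, hA, hAj⟩ := hφ i j.1 hji
        refine Or.inr ⟨A, hA, fun a ha => ?_⟩
        simpa using hAj ((φ i).symm a) ha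

/-- The `w`-th row of a grid `g` with missing column `x`, the missing entry being `v w`. -/
noncomputable def gridRow {W V : Type*} (x : W) (v : W → V) (g : W × {y : W // y ≠ x} → V)
    (w y : W) : V :=
  if h : y = x then v w else g (w, ⟨y, h⟩)

/-- A grid of vertices whose columns span copies of `F` and whose rows, completed by the
vertices `v w`, also span copies of `F`. -/
structure IsAbsorber {W V : Type*} {k : ℕ} (F : UniformHypergraph W k)
    (H : UniformHypergraph V k) (x : W) (v : W → V) (g : W × {y : W // y ≠ x} → V) : Prop where
  injective : Function.Injective g
  ne : ∀ z w, g z ≠ v w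
  row : ∀ w, ∀ e ∈ F.edges, e.image (gridRow x v g w) ∈ H.edges
  col : ∀ y, ∀ e ∈ F.edges, e.image (fun w => g (w, y)) ∈ H.edges

/-- All row edges are imposed before all column edges. A column edge meets a row edge in at most one
cell, which is harmless for it because `I` covers `[k]`. The reverse order could fail, as `J` need
not cover `[k-1]`. -/
theorem le_numSat_isAbsorber {W V : Type*} [Fintype W] [Fintype V] {k m m' : ℕ}
    {F : UniformHypergraph W k} {H : UniformHypergraph V k} {I : Finset (Finset (Fin k))}
    {J : Finset (Finset (Fin (k - 1)))} (hcov : ∀ a : Fin k, ∃ A ∈ I, a ∈ A)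
    (E' : Fin m' ≃ {e : Finset W // e ∈ F.edges})
    (φ : ∀ i : Fin m', {y : W // y ∈ (E' i).1} ≃ Fin k)
    (hφ : ∀ i j : Fin m', j < i →
      ∃ A ∈ I, ∀ y : {y : W // y ∈ (E' i).1}, y.1 ∈ (E' j).1 → φ i y ∈ A)
    (x : W) (E : Fin m ≃ {e : Finset W // e ∈ F.edges})
    (ψ : ∀ i : Fin m, {y : W // y ∈ (E i).1} ≃ Fin k)
    (hψk : ∀ i (hx : x ∈ (E i).1), (ψ i ⟨x, hx⟩ : ℕ) + 1 = k)
    (hψI : ∀ i j : Fin m, j < i → x ∉ (E i).1 →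
      ∃ A ∈ I, ∀ y : {y : W // y ∈ (E i).1}, y.1 ∈ (E j).1 → ψ i y ∈ A)
    (hψJ : ∀ i j : Fin m, j < i → x ∈ (E i).1 →
      ∃ B ∈ J, ∀ y : {y : W // y ∈ (E i).1}, y.1 ∈ (E j).1 → y.1 ≠ x →
          ψ i y ∈ B.map (Fin.castLEEmb (Nat.sub_le k 1)))
    {p α q ν : ℝ} (hq0 : 0 ≤ q) (hq1 : q ≤ 1) (hqp : q ≤ p) (hqα : q ≤ α) (hν : 0 ≤ ν)
    (hD : OrderedDisc I p ν (fun y : Fin k → V => univ.image y ∈ H.edges))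
    (hDlink : ∀ u : V, OrderedDisc J α ν
      (fun y : Fin (k - 1) → V => insert u (univ.image y) ∈ H.edges))
    (hV : 0 < Fintype.card V) (v : W → V) :
    (q ^ (Fintype.card W * m + Fintype.card {y : W // y ≠ x} * m') -
        ((Fintype.card W * m + Fintype.card {y : W // y ≠ x} * m' : ℕ) : ℝ) * ν -
        ((Fintype.card (W × {y : W // y ≠ x}) : ℝ) ^ 2 +
          Fintype.card (W × {y : W // y ≠ x}) * Fintype.card W) / Fintype.card V) *
      (Fintype.card V : ℝ) ^ Fintype.card (W × {y : W // y ≠ x}) ≤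
    numSat (IsAbsorber F H x v) := by
  have hV' : (0 : ℝ) < Fintype.card V := by exact_mod_cast hV
  set X := W × {y : W // y ≠ x} with hX
  set N : ℝ := (Fintype.card V : ℝ) ^ Fintype.card X with hN
  have hN0 : 0 < N := by positivity
  let C : (W × Fin m) ⊕ ({y : W // y ≠ x} × Fin m') → (X → V) → Prop :=
    Sum.elim (fun j g => (E j.2).1.image (gridRow x v g j.1) ∈ H.edges)
      fun j g => (E' j.2).1.image (fun w => g (w, j.1)) ∈ H.edges
  let supp : (W × Fin m) ⊕ ({y : W // y ≠ x} × Fin m') → Set X :=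
    Sum.elim (fun j => {z | z.1 = j.1 ∧ z.2.1 ∈ (E j.2).1})
      fun j => {z | z.2 = j.1 ∧ z.1 ∈ (E' j.2).1}
  let rank : (W × Fin m) ⊕ ({y : W // y ≠ x} × Fin m') → ℕ :=
    Sum.elim (fun j => j.2) fun j => m + j.2
  have hsupp : ∀ j g g', (∀ z ∈ supp j, g z = g' z) → C j g → C j g' := by
    rintro (⟨w, j⟩ | ⟨y, j⟩) g g' hgg hC
    · simp only [C, Sum.elim_inl] at hC ⊢
      rwa [← image_congr (f := gridRow x v g w) fun y hy => ?_]
      by_cases hyx : y = x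
      · simp [gridRow, hyx]
      · simp only [gridRow, hyx, dif_neg, not_false_eq_true]
        exact hgg (w, ⟨y, hyx⟩) ⟨rfl, hy⟩
    · simp only [C, Sum.elim_inr] at hC ⊢
      rwa [← image_congr (f := fun w => g (w, y)) fun w hw => ?_]
      exact hgg (w, y) ⟨rfl, hw⟩
  have hcount := le_numSat_forall_mem (Ω := X → V) rank (fun _ => True) C (N := N) (c := 1)
    hq0 hq1 hν hN0.le (by rw [numSat_true]; simp [hN]) ?_ univ
  · simp only [card_univ, Fintype.card_sum, Fintype.card_prod, Fintype.card_fin, mul_one]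
      at hcount
    have hni := card_mul_numSat_not_injective_le X V
    have hhit := card_mul_numSat_exists_mem_le (X := X) (univ.image v)
    rw [← hN] at hni hhit
    have hcard : ((univ.image v).card : ℝ) ≤ Fintype.card W := by
      exact_mod_cast card_image_le
    have hhit' : (Fintype.card V : ℝ) * numSat (fun g : X → V => ∃ z, g z ∈ univ.image v) ≤
        Fintype.card X * Fintype.card W * N := hhit.trans (by gcongr)
    have hsplit : numSat (fun g : X → V => True ∧ ∀ j ∈ univ, C j g) ≤
        numSat (IsAbsorber F H x v) + (numSat (fun g : X → V => ¬ Function.Injective g) +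
          numSat (fun g : X → V => ∃ z, g z ∈ univ.image v)) := by
      refine (numSat_le_add (R := fun g : X → V => ¬ Function.Injective g ∨
        ∃ z, g z ∈ univ.image v) fun g hg => ?_).trans (add_le_add le_rfl (numSat_or_le _ _))
      by_contra! hcon
      obtain ⟨hno, hinj, hmem⟩ := hcon
      refine hno ⟨hinj, fun z w hzw => hmem z (mem_image.2 ⟨w, mem_univ _, hzw.symm⟩),
        fun w e he => ?_, fun y e he => ?_⟩
      · have := hg.2 (Sum.inl (w, E.symm ⟨e, he⟩)) (mem_univ _)
        simpa [C] using this
      · have := hg.2 (Sum.inr (y, E'.symm ⟨e, he⟩)) (mem_univ _)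
        simpa [C] using this
    have hdiv : ((Fintype.card X : ℝ) ^ 2 + Fintype.card X * Fintype.card W) /
        Fintype.card V * N ≥ numSat (fun g : X → V => ¬ Function.Injective g) +
          numSat (fun g : X → V => ∃ z, g z ∈ univ.image v) := by
      rw [ge_iff_le, div_mul_eq_mul_div, le_div_iff₀ hV']
      linarith
    rw [sub_mul]
    linarith
  · intro i s his hs
    have hmain : ∀ (r : ℕ) (L : Finset (Finset (Fin r))) (q' : ℝ) (D : (Fin r → V) → Prop)
        (e : Fin r → X), q ≤ q' → OrderedDisc L q' ν D → Function.Injective e →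
        (∀ g, D (g ∘ e) ↔ C i g) →
        (∀ j ∈ s, (∀ a, e a ∉ supp j) ∨ ∃ A ∈ L, ∀ a, e a ∈ supp j → a ∈ A) →
        q * numSat (fun g => True ∧ ∀ j ∈ s, C j g) - ν * N ≤
          numSat (fun g => (True ∧ ∀ j ∈ s, C j g) ∧ C i g) := by
      intro r L q' D e hqq hD he hDe hj
      have hstep := hD.numSat_and hν hV ⟨e, he⟩ (κ := {j // j ∈ s}) (fun j => C j.1)
        (fun j => supp j.1) (fun j => hsupp j.1) fun j => hj j.1 j.2
      have hle : q * numSat (fun g => True ∧ ∀ j ∈ s, C j g) ≤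
          q' * numSat (fun g => ∀ j : {j // j ∈ s}, C j.1 g) := by
        refine mul_le_mul hqq (numSat_mono fun g hg j => hg.2 j.1 j.2) (numSat_nonneg _)
          (hq0.trans hqq)
      refine le_trans (sub_le_sub_right hle _) (hstep.trans (numSat_mono fun g hg => ?_))
      exact ⟨⟨trivial, fun j hj => hg.1 ⟨j, hj⟩⟩, (hDe g).1 hg.2⟩
    rcases i with ⟨w, i⟩ | ⟨y, i⟩
    · have hrow : ∀ j ∈ s, (∃ w' j', j = Sum.inl (w', j') ∧ w' ≠ w) ∨
          ∃ j', j = Sum.inl (w, j') ∧ j' < i := by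
        rintro (⟨w', j'⟩ | ⟨y, j'⟩) hjs
        · by_cases hw : w' = w
          · subst hw
            have := hs _ hjs
            simp only [rank, Sum.elim_inl, Fin.val_fin_le] at this
            exact Or.inr ⟨j', rfl, lt_of_le_of_ne this fun h => his (h ▸ hjs)⟩
          · exact Or.inl ⟨w', j', rfl, hw⟩
        · have := hs _ hjs
          simp only [rank, Sum.elim_inl, Sum.elim_inr] at this
          omega
      -- If the edge contains `x`, that entry is the fixed vertex `v w`, so only `k - 1` coordinates
      -- vary and the link of `v w` is used; otherwise `H` itself is used.
      by_cases hx : x ∈ (E i).1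
      · have hlast : ∀ y : {y : W // y ∈ (E i).1}, y.1 ≠ x → (ψ i y : ℕ) < k - 1 := by
          intro y hy
          have h1 := hψk i hx
          have h2 := (ψ i y).2
          have h3 : (ψ i y : ℕ) ≠ ψ i ⟨x, hx⟩ := fun h =>
            hy (congrArg Subtype.val ((ψ i).injective (Fin.ext h)))
          omega
        have hne : ∀ a : Fin (k - 1),
            ((ψ i).symm (Fin.castLE (Nat.sub_le k 1) a)).1 ≠ x := by
          intro a ha
          have h1 := hψk i hx
          have h2 : (ψ i).symm (Fin.castLE (Nat.sub_le k 1) a) = ⟨x, hx⟩ := Subtype.ext ha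
          rw [← h2, Equiv.apply_symm_apply, Fin.val_castLE] at h1
          have := a.2
          omega
        refine hmain (k - 1) J α _ (fun a => (w, ⟨_, hne a⟩)) hqα (hDlink (v w)) ?_ ?_ ?_
        · intro a b hab
          exact Fin.castLE_injective _ ((ψ i).symm.injective
            (Subtype.ext (congrArg (fun z : X => z.2.1) hab)))
        · intro g
          have himage : insert (v w) (univ.image
              (g ∘ fun a : Fin (k - 1) =>
                ((w, ⟨((ψ i).symm (Fin.castLE (Nat.sub_le k 1) a)).1, hne a⟩) : X))) =
              (E i).1.image (gridRow x v g w) := by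
            ext u
            simp only [mem_insert, mem_image, mem_univ, true_and, Function.comp_apply]
            constructor
            · rintro (rfl | ⟨a, rfl⟩)
              · exact ⟨x, hx, by simp [gridRow]⟩
              · exact ⟨_, ((ψ i).symm (Fin.castLE (Nat.sub_le k 1) a)).2, by
                  simp [gridRow, hne a]⟩
            · rintro ⟨y, hy, rfl⟩
              by_cases hyx : y = x
              · exact Or.inl (by simp [gridRow, hyx])
              · refine Or.inr ⟨⟨ψ i ⟨y, hy⟩, hlast _ hyx⟩, ?_⟩
                simp only [gridRow, hyx, dif_neg, not_false_eq_true, Fin.castLE_mk, Fin.eta,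
                  Equiv.symm_apply_apply]
          simp only [himage]
          rfl
        · intro j hj
          obtain ⟨w', j', rfl, hw⟩ | ⟨j', rfl, hji⟩ := hrow j hj
          · exact Or.inl fun a ha => hw ha.1.symm
          · obtain ⟨B, hB, hBj⟩ := hψJ i j' hji hx
            refine Or.inr ⟨B, hB, fun a ha => ?_⟩
            have := hBj ((ψ i).symm (Fin.castLE (Nat.sub_le k 1) a)) ha.2 (hne a)
            rw [Equiv.apply_symm_apply, mem_map] at this
            obtain ⟨b, hb, hba⟩ := this
            rwa [← Fin.castLE_injective _ hba]
      · have hne : ∀ a, ((ψ i).symm a).1 ≠ x := fun a ha => hx (ha ▸ ((ψ i).symm a).2)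
        refine hmain k I p _ (fun a => (w, ⟨((ψ i).symm a).1, hne a⟩)) hqp hD ?_ ?_ ?_
        · intro a b hab
          exact (ψ i).symm.injective (Subtype.ext (congrArg (fun z : X => z.2.1) hab))
        · intro g
          have himage := image_comp_equiv_symm (ψ i) (gridRow x v g w)
          simp only [gridRow, hne, dif_neg, not_false_eq_true] at himage
          simp only [Function.comp_def, himage]
          rfl
        · intro j hj
          obtain ⟨w', j', rfl, hw⟩ | ⟨j', rfl, hji⟩ := hrow j hj
          · exact Or.inl fun a ha => hw ha.1.symm
          · obtain ⟨A, hA, hAj⟩ := hψI i j' hji hx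
            refine Or.inr ⟨A, hA, fun a ha => ?_⟩
            simpa using hAj ((ψ i).symm a) ha.2
    · refine hmain k I p _ (fun a => (((φ i).symm a).1, y)) hqp hD ?_ ?_ ?_
      · intro a b hab
        exact (φ i).symm.injective (Subtype.ext (congrArg (fun z : X => z.1) hab))
      · intro g
        have himage := image_comp_equiv_symm (φ i) (fun w => g (w, y))
        simp only [Function.comp_def, himage]
        rfl
      · rintro (⟨w, j'⟩ | ⟨y', j'⟩) hjs
        -- The only cell that row `w` shares with the current column is `(w, y)`.
        · by_cases hw : w ∈ (E' i).1
          · obtain ⟨A, hA, hwA⟩ := hcov (φ i ⟨w, hw⟩)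
            refine Or.inr ⟨A, hA, fun a ha => ?_⟩
            have : (φ i).symm a = ⟨w, hw⟩ := Subtype.ext ha.1
            rwa [← this, Equiv.apply_symm_apply] at hwA
          · refine Or.inl fun a ha => hw ?_
            have ha' : ((φ i).symm a).1 = w := ha.1
            exact ha' ▸ ((φ i).symm a).2
        · by_cases hy : y' = y
          · subst hy
            have := hs _ hjs
            simp only [rank, Sum.elim_inr, add_le_add_iff_left, Fin.val_fin_le] at this
            obtain ⟨A, hA, hAj⟩ := hφ i j' (lt_of_le_of_ne this fun h => his (h ▸ hjs))
            refine Or.inr ⟨A, hA, fun a ha => ?_⟩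
            simpa using hAj ((φ i).symm a) ha.2
          · exact Or.inl fun a ha => hy ha.1.symm

end Embedding

/-! ### Packable sets, absorption, and the choice of a disjoint absorbing family -/

section Packing

open Finset
open scoped Classical

/-- Vertex sets that can be partitioned into copies of `F`. -/
inductive IsPackable {W V : Type*} [Fintype W] {k : ℕ} (F : UniformHypergraph W k)
    (H : UniformHypergraph V k) : Finset V → Prop
  | empty : IsPackable F H ∅
  | union (q : W ↪ V) (S : Finset V) : F.IsLabeledCopy H q → Disjoint (univ.map q) S →
      IsPackable F H S → IsPackable F H (univ.map q ∪ S)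

namespace IsPackable

variable {W V : Type*} [Fintype W] {k : ℕ} {F : UniformHypergraph W k}
  {H : UniformHypergraph V k}

theorem of_isLabeledCopy {q : W ↪ V} (hq : F.IsLabeledCopy H q) :
    IsPackable F H (univ.map q) := by
  simpa using IsPackable.union q ∅ hq (by simp) .empty

theorem disjUnion {S T : Finset V} (hS : IsPackable F H S) (hT : IsPackable F H T)
    (h : Disjoint S T) : IsPackable F H (S ∪ T) := by
  induction hS with
  | empty => simpa
  | union q S hq hqS _ ih =>
    rw [disjoint_union_left] at h
    rw [union_assoc]
    exact .union q _ hq (disjoint_union_right.2 ⟨hqS, h.1⟩) (ih h.2)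

theorem card_dvd {S : Finset V} (hS : IsPackable F H S) : Fintype.card W ∣ S.card := by
  induction hS with
  | empty => simp
  | union q S hq hqS _ ih =>
    rw [card_union_of_disjoint hqS, card_map, card_univ]
    exact dvd_add dvd_rfl ih

theorem biUnion {ι : Type*} (s : Finset ι) (f : ι → Finset V)
    (hf : ∀ i ∈ s, IsPackable F H (f i)) (hd : (s : Set ι).PairwiseDisjoint f) :
    IsPackable F H (s.biUnion f) := by
  induction s using Finset.induction_on with
  | empty => simpa using IsPackable.empty
  | insert i s hi ih =>
    rw [biUnion_insert]
    refine (hf i (mem_insert_self _ _)).disjUnion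
      (ih (fun j hj => hf j (mem_insert_of_mem hj)) (hd.subset (by simp))) ?_
    rw [disjoint_biUnion_right]
    intro j hj
    exact hd (by simp) (by simp [hj]) fun h => hi (h ▸ hj)

theorem exists_partition {S : Finset V} (hS : IsPackable F H S) :
    ∃ (t : ℕ) (q : Fin t → W ↪ V), (∀ i, F.IsLabeledCopy H (q i)) ∧
      (∀ i j, i ≠ j → Disjoint (Set.range (q i)) (Set.range (q j))) ∧
      (⋃ i, Set.range (q i)) = (S : Set V) := by
  induction hS with
  | empty => exact ⟨0, Fin.elim0, fun i => i.elim0, fun i => i.elim0, by simp⟩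
  | union q S hq hqS _ ih =>
    obtain ⟨t, q', h1, h2, h3⟩ := ih
    have hdisj : ∀ i, Disjoint (Set.range q) (Set.range (q' i)) := by
      intro i
      have : Set.range (q' i) ⊆ (S : Set V) := h3 ▸ Set.subset_iUnion (fun i => Set.range (q' i)) i
      refine Disjoint.mono_right this ?_
      have := disjoint_coe.2 hqS
      simpa using this
    refine ⟨t + 1, Fin.cons q q', ?_, ?_, ?_⟩
    · exact Fin.cases (by simpa using hq) (by simpa using h1)
    · refine Fin.cases (Fin.cases (by simp) fun j _ => ?_) fun i => Fin.cases (fun _ => ?_)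
        fun j hij => ?_
      · simpa using hdisj j
      · simpa using (hdisj i).symm
      · simpa using h2 i j fun h => hij (h ▸ rfl)
    · ext u
      have := Set.ext_iff.1 h3 u
      simp only [Set.mem_iUnion, Set.mem_range, mem_coe] at this
      simp [Fin.exists_fin_succ, this]

theorem hasPerfectPacking [Fintype V] (h : IsPackable F H univ) : F.HasPerfectPacking H := by
  simpa [UniformHypergraph.HasPerfectPacking] using h.exists_partition

end IsPackable

section Absorber

variable {W V : Type*} [Fintype W] {k : ℕ} {F : UniformHypergraph W k}
  {H : UniformHypergraph V k} {x : W}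

theorem IsAbsorber.isPackable {v : W → V} {g : W × {y : W // y ≠ x} → V}
    (h : IsAbsorber F H x v g) : IsPackable F H (univ.image g) := by
  let q : {y : W // y ≠ x} → W ↪ V := fun y =>
    ⟨fun w => g (w, y), fun a b hab => congrArg Prod.fst (h.injective hab)⟩
  have : univ.image g = univ.biUnion fun y => univ.map (q y) := by
    ext u
    simp only [mem_image, mem_univ, true_and, mem_biUnion, mem_map]
    exact ⟨fun ⟨z, hz⟩ => ⟨z.2, z.1, hz⟩, fun ⟨y, w, hz⟩ => ⟨(w, y), hz⟩⟩
  rw [this]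
  refine IsPackable.biUnion _ _ (fun y _ => .of_isLabeledCopy fun e he => ?_) ?_
  · rw [map_eq_image]
    exact h.col y e he
  · intro y _ y' _ hyy
    refine disjoint_left.2 fun u hu hu' => hyy ?_
    obtain ⟨w, -, rfl⟩ := mem_map.1 hu
    obtain ⟨w', -, hw⟩ := mem_map.1 hu'
    exact (congrArg Prod.snd (h.injective hw)).symm

theorem IsAbsorber.isPackable_union {v : W ↪ V} {g : W × {y : W // y ≠ x} → V}
    (h : IsAbsorber F H x v g) : IsPackable F H (univ.image g ∪ univ.map v) := by
  have hrow : ∀ w w' y y', gridRow x v g w y = gridRow x v g w' y' → w = w' ∧ y = y' := by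
    intro w w' y y' hyy
    by_cases hy : y = x <;> by_cases hy' : y' = x <;>
      simp only [gridRow, hy, hy', dif_pos, dif_neg, not_false_eq_true] at hyy
    · exact ⟨v.injective hyy, hy.trans hy'.symm⟩
    · exact absurd hyy.symm (h.ne _ _)
    · exact absurd hyy (h.ne _ _)
    · simpa using h.injective hyy
  let q : W → W ↪ V := fun w => ⟨gridRow x v g w, fun a b hab => (hrow w w a b hab).2⟩
  have hq : ∀ w y, q w y = gridRow x v g w y := fun _ _ => rfl
  have : univ.image g ∪ univ.map v = univ.biUnion fun w => univ.map (q w) := by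
    ext u
    simp only [mem_union, mem_image, mem_univ, true_and, mem_biUnion, mem_map]
    constructor
    · rintro (⟨⟨w, y⟩, rfl⟩ | ⟨w, rfl⟩)
      · exact ⟨w, y.1, by simp [hq, gridRow, y.2]⟩
      · exact ⟨w, x, by simp [hq, gridRow]⟩
    · rintro ⟨w, y, rfl⟩
      by_cases hy : y = x
      · exact Or.inr ⟨w, by simp [hq, gridRow, hy]⟩
      · exact Or.inl ⟨(w, ⟨y, hy⟩), by simp [hq, gridRow, hy]⟩
  rw [this]
  refine IsPackable.biUnion _ _ (fun w _ => .of_isLabeledCopy fun e he => ?_) ?_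
  · rw [map_eq_image]
    exact h.row w e he
  · intro w _ w' _ hww
    refine disjoint_left.2 fun u hu hu' => hww ?_
    obtain ⟨y, -, rfl⟩ := mem_map.1 hu
    obtain ⟨y', -, hy⟩ := mem_map.1 hu'
    exact (hrow _ _ _ _ hy).1.symm

/-- A family of disjoint absorbers packs any small set of vertices. -/
theorem IsPackable.union_biUnion_absorbers (r : ℕ) :
    ∀ (T : Finset (W × {y : W // y ≠ x} → V)) (L : Finset V),
      (∀ g ∈ T, IsPackable F H (univ.image g)) →
      ((T : Set (W × {y : W // y ≠ x} → V)).PairwiseDisjoint fun g => univ.image g) →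
      Disjoint L (T.biUnion fun g => univ.image g) → L.card = Fintype.card W * r →
      (∀ v : W ↪ V, r ≤ (T.filter (IsAbsorber F H x v)).card) →
      IsPackable F H (L ∪ T.biUnion fun g => univ.image g) := by
  induction r with
  | zero =>
    intro T L hT hd _ hL _
    rw [mul_zero, card_eq_zero] at hL
    rw [hL, empty_union]
    exact IsPackable.biUnion _ _ hT hd
  | succ r ih =>
    intro T L hT hd hLT hL hv
    obtain ⟨L₀, hL₀, hcard⟩ := exists_subset_card_eq (s := L) (n := Fintype.card W)
      (by rw [hL]; exact Nat.le_mul_of_pos_right _ r.succ_pos)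
    let v : W ↪ V := (Fintype.equivOfCardEq (by simp [hcard]) : W ≃ L₀).toEmbedding.trans
      (Function.Embedding.subtype _)
    have hvL : univ.map v = L₀ := by
      ext u
      simp only [mem_map, mem_univ, true_and, v, Function.Embedding.trans_apply,
        Equiv.coe_toEmbedding, Function.Embedding.subtype_apply]
      constructor
      · rintro ⟨w, rfl⟩
        exact Subtype.prop _
      · intro hu
        exact ⟨(Fintype.equivOfCardEq (by simp [hcard]) : W ≃ L₀).symm ⟨u, hu⟩, by simp⟩
    -- One batch `L₀` uses up one absorber; erasing it lowers the supply of every other tuple by at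
    -- most one.
    obtain ⟨g, hg⟩ := card_pos.1 (r.succ_pos.trans_le (hv v))
    obtain ⟨hgT, hgv⟩ := mem_filter.1 hg
    have hsub : ((T.erase g : Finset _) : Set (W × {y : W // y ≠ x} → V)) ⊆ T := by simp
    have hTins : T.biUnion (fun g => univ.image g) =
        univ.image g ∪ (T.erase g).biUnion fun g => univ.image g := by
      rw [← biUnion_insert (t := fun g => univ.image g), insert_erase hgT]
    have hgd : Disjoint (univ.image g) ((T.erase g).biUnion fun g => univ.image g) := by
      rw [disjoint_biUnion_right]
      intro g' hg'
      exact hd hgT (mem_of_mem_erase hg') (ne_of_mem_erase hg').symm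
    rw [hTins, disjoint_union_right] at hLT
    have hrec := ih (T.erase g) (L \ L₀) (fun g' hg' => hT g' (mem_of_mem_erase hg'))
      (hd.subset hsub) (hLT.2.mono_left sdiff_subset)
      (by rw [card_sdiff_of_subset hL₀, hL, hcard, mul_add, mul_one, Nat.add_sub_cancel])
      fun v' => by
        rw [filter_erase]
        have := hv v'
        have := pred_card_le_card_erase (s := T.filter (IsAbsorber F H x v')) (a := g)
        omega
    have heq : L ∪ T.biUnion (fun g => univ.image g) =
        (univ.image g ∪ univ.map v) ∪
          ((L \ L₀) ∪ (T.erase g).biUnion fun g => univ.image g) := by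
      rw [hTins, hvL]
      ext u
      simp only [mem_union, mem_sdiff]
      have := @hL₀ u
      tauto
    rw [heq]
    refine hgv.isPackable_union.disjUnion hrec ?_
    rw [hvL, disjoint_union_left, disjoint_union_right, disjoint_union_right]
    exact ⟨⟨(hLT.1.mono_left sdiff_subset).symm, hgd⟩, disjoint_sdiff, hLT.2.mono_left hL₀⟩

end Absorber

/-- Greedily packing copies of `F` leaves only few vertices uncovered. -/
theorem exists_isPackable_sdiff {W V : Type*} [Fintype W] [Nonempty W] {k : ℕ}
    {F : UniformHypergraph W k} {H : UniformHypergraph V k} {a : ℝ}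
    (hcopy : ∀ S : Finset V, a ≤ S.card → ∃ q : W ↪ V, F.IsLabeledCopy H q ∧ ∀ w, q w ∈ S)
    (S : Finset V) : ∃ L ⊆ S, (L.card : ℝ) < a ∧ IsPackable F H (S \ L) := by
  induction S using Finset.strongInduction with
  | H S ih =>
    by_cases hS : a ≤ S.card
    · obtain ⟨q, hq, hqS⟩ := hcopy S hS
      have hsub : univ.map q ⊆ S := fun u hu => by
        obtain ⟨w, -, rfl⟩ := mem_map.1 hu
        exact hqS w
      obtain ⟨L, hL, hLc, hLp⟩ := ih (S \ univ.map q) (sdiff_ssubset hsub (by simp))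
      refine ⟨L, hL.trans sdiff_subset, hLc, ?_⟩
      have : S \ L = univ.map q ∪ ((S \ univ.map q) \ L) := by
        ext u
        have h1 := @hsub u
        have h2 := @hL u
        simp only [mem_union, mem_sdiff] at h2 ⊢
        tauto
      rw [this]
      refine .union q _ hq ?_ hLp
      exact disjoint_sdiff.mono_right sdiff_subset
    · exact ⟨S, subset_rfl, not_le.1 hS, by simpa using IsPackable.empty⟩

/-- If every `G i` contains a positive proportion of all tuples, there are linearly many disjoint
tuples, many of which belong to each `G i`. -/
theorem exists_pairwiseDisjoint_tuples {X V ι : Type*} [Fintype X] [DecidableEq X] [Nonempty X]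
    [Fintype V] [Fintype ι] [Nonempty ι] (hV : 0 < Fintype.card V) (G : ι → (X → V) → Prop)
    {c : ℝ} (hc : 0 < c) (hG : ∀ i, c * (Fintype.card V : ℝ) ^ Fintype.card X ≤ numSat (G i))
    (t : ℕ) (ht : (Fintype.card X : ℝ) ^ 2 * t ≤ c / 2 * Fintype.card V) :
    ∃ T : Finset (X → V), T.card = t ∧ (∀ g ∈ T, ∃ i, G i g) ∧
      ((T : Set (X → V)).PairwiseDisjoint fun g => univ.image g) ∧
      ∑ i, (1 / 2 : ℝ) ^ (T.filter (G i)).card ≤ Fintype.card ι * (1 - c / 4) ^ t := by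
  have hV' : (0 : ℝ) < Fintype.card V := by exact_mod_cast hV
  -- The sum of `(1 / 2) ^ hits` is a potential: choosing each new tuple to decrease it replaces a
  -- random selection, and a small final sum bounds every single term, forcing many hits for each
  -- `i`.
  induction t with
  | zero => exact ⟨∅, by simp, by simp, by simp, by simp⟩
  | succ t ih =>
    obtain ⟨T, hTt, hTG, hTd, hT⟩ := ih (le_trans (by gcongr; simp) ht)
    set N : ℝ := (Fintype.card V : ℝ) ^ Fintype.card X with hN
    have hN0 : 0 < N := by positivity
    set U : Finset V := T.biUnion fun g => univ.image g with hU
    have hUcard : (U.card : ℝ) ≤ t * Fintype.card X := by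
      have : U.card ≤ T.card * Fintype.card X :=
        card_biUnion_le_card_mul _ _ _ fun g _ => card_image_le
      rw [hTt] at this
      exact_mod_cast this
    have hbad : numSat (fun g : X → V => ∃ z, g z ∈ U) ≤ c / 2 * N := by
      have h1 := card_mul_numSat_exists_mem_le (X := X) U
      rw [← hN] at h1
      have h2 : (Fintype.card X : ℝ) * U.card ≤ c / 2 * Fintype.card V := by
        calc (Fintype.card X : ℝ) * U.card ≤ Fintype.card X * (t * Fintype.card X) := by gcongr
          _ = (Fintype.card X : ℝ) ^ 2 * t := by ring
          _ ≤ (Fintype.card X : ℝ) ^ 2 * (t + 1 : ℕ) := by gcongr; simp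
          _ ≤ _ := ht
      refine le_of_mul_le_mul_left (h1.trans ?_) hV'
      calc _ ≤ (c / 2 * Fintype.card V) * N := by gcongr
        _ = _ := by ring
    set A : Finset (X → V) := univ.filter fun g => (∃ i, G i g) ∧ ∀ z, g z ∉ U with hA
    have hGA : ∀ i, c / 2 * N ≤ ((A.filter (G i)).card : ℝ) := by
      intro i
      have h1 : numSat (G i) ≤ ((A.filter (G i)).card : ℝ) +
          numSat (fun g : X → V => ∃ z, g z ∈ U) := by
        rw [hA, filter_filter, ← numSat_eq_card]
        refine numSat_le_add fun g hg => ?_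
        by_cases h : ∃ z, g z ∈ U
        · exact Or.inr h
        · push Not at h
          exact Or.inl ⟨⟨⟨i, hg⟩, h⟩, hg⟩
      have := hG i
      linarith
    have hAN : (A.card : ℝ) ≤ N := by
      rw [hN, ← Nat.cast_pow]
      refine Nat.cast_le.2 ((card_le_univ _).trans (by simp))
    have hAne : A.Nonempty := by
      rw [← card_pos]
      have i : ι := Classical.arbitrary ι
      have h1 : (0 : ℝ) < (A.filter (G i)).card := lt_of_lt_of_le (by positivity) (hGA i)
      exact lt_of_lt_of_le (by exact_mod_cast h1) (card_le_card (filter_subset _ _))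
    have hnotin : ∀ g ∈ A, g ∉ T := by
      intro g hg hgT
      have hz := (mem_filter.1 hg).2.2 (Classical.arbitrary X)
      exact hz (mem_biUnion.2 ⟨g, hgT, mem_image_of_mem _ (mem_univ _)⟩)
    have hins : ∀ g ∈ A, ∀ i, (1 / 2 : ℝ) ^ ((insert g T).filter (G i)).card =
        (1 / 2 : ℝ) ^ (T.filter (G i)).card * (1 - if G i g then 1 / 2 else 0) := by
      intro g hg i
      rw [filter_insert]
      split_ifs with h
      · rw [card_insert_of_notMem fun hmem => hnotin g hg (mem_filter.1 hmem).1, pow_succ]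
        norm_num
      · simp
    -- Average over `A`: a proportion at least `c / 2` of it lies in `G i` and halves the `i`-th
    -- term, which gives the factor `1 - c / 4`.
    obtain ⟨g, hgA, hg⟩ : ∃ g ∈ A, ∑ i, (1 / 2 : ℝ) ^ ((insert g T).filter (G i)).card ≤
        (∑ i, (1 / 2 : ℝ) ^ (T.filter (G i)).card) * (1 - c / 4) := by
      refine exists_le_of_sum_le hAne ?_
      rw [sum_const, nsmul_eq_mul, sum_comm, sum_mul, mul_sum]
      refine sum_le_sum fun i _ => ?_
      rw [sum_congr rfl fun g hg => hins g hg i, ← mul_sum, sum_sub_distrib, sum_const,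
        nsmul_eq_mul, mul_one, ← sum_filter, sum_const, nsmul_eq_mul, mul_left_comm]
      refine mul_le_mul_of_nonneg_left ?_ (by positivity)
      have h1 := hGA i
      have h2 : (A.card : ℝ) * (c / 4) ≤ N * (c / 4) := by gcongr
      linarith
    have hc4 : 0 ≤ 1 - c / 4 := by
      have i : ι := Classical.arbitrary ι
      have h1 : c * N ≤ N := (hG i).trans <| by
        refine (numSat_mono fun _ _ => trivial).trans (le_of_eq ?_) (b := numSat fun _ => True)
        rw [numSat_true]; simp [hN]
      have h2 : c ≤ 1 := by
        by_contra! h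
        nlinarith
      linarith
    refine ⟨insert g T, by rw [card_insert_of_notMem (hnotin g hgA), hTt], ?_, ?_, ?_⟩
    · rw [forall_mem_insert]
      exact ⟨(mem_filter.1 hgA).2.1, hTG⟩
    · rw [coe_insert]
      refine hTd.insert fun g' hg' _ => disjoint_left.2 fun u hu hu' => ?_
      obtain ⟨z, -, rfl⟩ := mem_image.1 hu
      exact (mem_filter.1 hgA).2.2 z (mem_biUnion.2 ⟨g', hg', hu'⟩)
    · refine hg.trans ?_
      rw [pow_succ, ← mul_assoc]
      gcongr

/-- With `l = -log ρ`, half of the exponential decay `exp (-l γ n)` pays for the polynomial factor,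
and `exp (-1) ≤ 1 / 2` turns what is left into a linear bound on `h`. -/
theorem exists_mul_le_of_half_pow_le (f : ℕ) {γ ρ : ℝ} (hγ : 0 < γ) (hρ0 : 0 < ρ) (hρ1 : ρ < 1) :
    ∃ δ : ℝ, 0 < δ ∧ ∀ᶠ n : ℕ in Filter.atTop, ∀ h : ℕ,
      (1 / 2 : ℝ) ^ h ≤ (n : ℝ) ^ f * ρ ^ ⌊γ * n⌋₊ → δ * n ≤ h := by
  have hl : 0 < -Real.log ρ := neg_pos.2 (Real.log_neg hρ0 hρ1)
  set l := -Real.log ρ with hldef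
  refine ⟨γ * l / 2, by positivity, ?_⟩
  have hlo := (isLittleO_pow_exp_pos_mul_atTop f (b := γ * l / 2) (by positivity)).bound
    (Real.exp_pos (-l))
  filter_upwards [tendsto_natCast_atTop_atTop.eventually hlo] with n hn h hh
  rw [Real.norm_of_nonneg (by positivity), Real.norm_of_nonneg (by positivity),
    ← Real.exp_add] at hn
  have h1 : ρ ^ ⌊γ * n⌋₊ ≤ Real.exp (l - l * γ * n) := by
    have hρ : ρ = Real.exp (-l) := by rw [hldef, neg_neg, Real.exp_log hρ0]
    rw [hρ, ← Real.exp_nat_mul]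
    refine Real.exp_le_exp.2 ?_
    have := Nat.lt_floor_add_one (γ * n)
    nlinarith
  have h2 : (1 / 2 : ℝ) ^ h ≤ Real.exp (-(γ * l / 2 * n)) := by
    calc _ ≤ _ := hh
      _ ≤ Real.exp (-l + γ * l / 2 * n) * Real.exp (l - l * γ * n) := by gcongr
      _ = _ := by rw [← Real.exp_add]; ring_nf
  have h3 : Real.exp (-(h : ℝ)) ≤ (1 / 2 : ℝ) ^ h := by
    rw [← mul_neg_one, Real.exp_nat_mul]
    gcongr
    rw [Real.exp_neg, one_div]
    exact inv_anti₀ (by norm_num) (by linarith [Real.add_one_le_exp (1 : ℝ)])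
  have := Real.exp_le_exp.1 (h3.trans h2)
  linarith

end Packing

/-! ### Assembling the perfect packing -/

section PerfectPacking

open Finset
open scoped Classical

/-- Since `k ≥ 2`, such an `F` has no edges. The case is separate because the absorber grid would
have no columns. -/
theorem UniformHypergraph.hasPerfectPacking_of_card_eq_one {W V : Type*} [Fintype W] [Fintype V]
    {k : ℕ} (hk : 2 ≤ k) (F : UniformHypergraph W k) (H : UniformHypergraph V k)
    (hW : Fintype.card W = 1) : F.HasPerfectPacking H := by
  obtain ⟨x, hx⟩ := Fintype.card_eq_one_iff.1 hW
  have : Subsingleton W := ⟨fun a b => (hx a).trans (hx b).symm⟩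
  let e := (Fintype.equivFin V).symm
  refine ⟨Fintype.card V, fun i => ⟨fun _ => e i, fun a b _ => Subsingleton.elim a b⟩,
    fun i d hd => ?_, fun i j hij => ?_, ?_⟩
  · have h1 := F.uniform d hd
    have h2 := card_le_univ d
    omega
  · rw [Set.disjoint_left]
    rintro _ ⟨a, rfl⟩ ⟨b, hb⟩
    exact hij (e.injective hb.symm)
  · refine Set.eq_univ_of_forall fun u => Set.mem_iUnion.2 ⟨e.symm u, x, ?_⟩
    simp

/-- The absorbing method: many absorbers for every tuple, together with copies of `F` in all large
sets of vertices, yield a perfect packing. -/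
theorem exists_absorbing_threshold {W : Type*} [Fintype W] (x : W)
    (hW : 2 ≤ Fintype.card W) {c : ℝ} (hc0 : 0 < c) (hc1 : c ≤ 1) :
    ∃ ε : ℝ, 0 < ε ∧ ∃ n₀ : ℕ, ∀ {V : Type*} [Fintype V] {k : ℕ} (F : UniformHypergraph W k)
      (H : UniformHypergraph V k), n₀ ≤ Fintype.card V → Fintype.card W ∣ Fintype.card V →
      (∀ S : Finset V, ε * Fintype.card V ≤ S.card →
        ∃ q : W ↪ V, F.IsLabeledCopy H q ∧ ∀ w, q w ∈ S) →
      (∀ v : W ↪ V, c * (Fintype.card V : ℝ) ^ Fintype.card (W × {y : W // y ≠ x}) ≤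
        numSat (IsAbsorber F H x v)) →
      F.HasPerfectPacking H := by
  set b := Fintype.card (W × {y : W // y ≠ x}) with hb
  obtain ⟨y, hy⟩ := Fintype.exists_ne_of_one_lt_card hW x
  have : Nonempty (W × {y : W // y ≠ x}) := ⟨(x, ⟨y, hy⟩)⟩
  have : Nonempty W := ⟨x⟩
  have hb0 : 0 < b := Fintype.card_pos
  have hb0' : (0 : ℝ) < b := by exact_mod_cast hb0
  -- Chosen so that `⌊γ n⌋` disjoint grids meet the size condition of
  -- `exists_pairwiseDisjoint_tuples`.
  set γ : ℝ := c / (2 * b ^ 2) with hγ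
  obtain ⟨ε, hε, hev⟩ := exists_mul_le_of_half_pow_le (Fintype.card W) (γ := γ)
    (ρ := 1 - c / 4) (by positivity) (by linarith) (by linarith)
  obtain ⟨n₁, hn₁⟩ := Filter.eventually_atTop.1 hev
  refine ⟨ε, hε, max n₁ (Fintype.card W), ?_⟩
  intro V _ k F H hn hdvd hcopy habs
  have hWV : Fintype.card W ≤ Fintype.card V := (le_max_right _ _).trans hn
  have : Nonempty (W ↪ V) := Function.Embedding.nonempty_of_card_le hWV
  have hV : 0 < Fintype.card V := by omega
  obtain ⟨T, -, hTG, hTd, hT⟩ := exists_pairwiseDisjoint_tuples hV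
    (fun (v : W ↪ V) g => IsAbsorber F H x v g) hc0 habs ⌊γ * Fintype.card V⌋₊ (by
      have h1 := Nat.floor_le (a := γ * Fintype.card V) (by positivity)
      calc (b : ℝ) ^ 2 * ⌊γ * Fintype.card V⌋₊ ≤ b ^ 2 * (γ * Fintype.card V) := by gcongr
        _ = _ := by rw [hγ]; field_simp)
  have hTp : ∀ g ∈ T, IsPackable F H (univ.image g) := fun g hg => by
    obtain ⟨v, hv⟩ := hTG g hg
    exact hv.isPackable
  have hhits : ∀ v : W ↪ V,
      ε * Fintype.card V ≤ (T.filter (IsAbsorber F H x v)).card := by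
    intro v
    refine hn₁ _ ((le_max_left _ _).trans hn) _ ?_
    calc (1 / 2 : ℝ) ^ (T.filter (IsAbsorber F H x v)).card
        ≤ ∑ v : W ↪ V, (1 / 2 : ℝ) ^ (T.filter (IsAbsorber F H x v)).card :=
          single_le_sum (f := fun v : W ↪ V => (1 / 2 : ℝ) ^ (T.filter (IsAbsorber F H x v)).card)
            (fun _ _ => by positivity) (mem_univ v)
      _ ≤ _ := hT
      _ ≤ _ := by
        refine mul_le_mul_of_nonneg_right ?_ (pow_nonneg (by linarith) _)
        rw [Fintype.card_embedding_eq]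
        exact_mod_cast Nat.descFactorial_le_pow _ _
  set M := T.biUnion fun g => univ.image g with hM
  obtain ⟨L, hLs, hLc, hLp⟩ := exists_isPackable_sdiff hcopy (univ \ M)
  have hLM : Disjoint L M := (disjoint_sdiff (s := M) (t := univ)).symm.mono_left hLs
  have hMp : IsPackable F H M := IsPackable.biUnion _ _ hTp hTd
  have hrest : Disjoint (L ∪ M) ((univ \ M) \ L) := by
    rw [disjoint_left]
    intro u
    simp only [mem_union, mem_sdiff, mem_univ, true_and]
    tauto
  have hcover : (L ∪ M) ∪ ((univ \ M) \ L) = univ := by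
    ext u
    simp only [mem_union, mem_sdiff, mem_univ, true_and, iff_true]
    tauto
  -- Everything outside `L` is packable, so divisibility passes from the whole vertex set to `L`.
  have hLdvd : Fintype.card W ∣ L.card := by
    have h1 := congrArg card hcover
    rw [card_union_of_disjoint hrest, card_union_of_disjoint hLM, card_univ] at h1
    have h2 := (Nat.dvd_add_left hLp.card_dvd).1 (h1 ▸ hdvd)
    exact (Nat.dvd_add_left hMp.card_dvd).1 h2
  obtain ⟨r, hr⟩ := hLdvd
  have hLMp := IsPackable.union_biUnion_absorbers r T L hTp hTd hLM hr fun v => by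
    have h1 : (r : ℝ) ≤ L.card := by
      rw [hr]
      exact_mod_cast Nat.le_mul_of_pos_left r (by omega)
    have h2 := h1.trans (hLc.le.trans (hhits v))
    exact_mod_cast h2
  refine IsPackable.hasPerfectPacking ?_
  rw [← hcover]
  exact hLMp.disjUnion hLp hrest

/-- In an adapted ordering, the first edge may also be labelled so that `x` gets the last label. -/
theorem exists_label_eq_last {W : Type*} {k m : ℕ} (hk : 0 < k) (x : W) (E : Fin m → Finset W)
    (ψ : ∀ i : Fin m, {y : W // y ∈ E i} ≃ Fin k)
    (hψ : ∀ i j : Fin m, j < i → ∀ hx : x ∈ E i, (ψ i ⟨x, hx⟩ : ℕ) + 1 = k) :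
    ∃ ψ' : ∀ i : Fin m, {y : W // y ∈ E i} ≃ Fin k,
      (∀ i (hx : x ∈ E i), (ψ' i ⟨x, hx⟩ : ℕ) + 1 = k) ∧ ∀ i j : Fin m, j < i → ψ' i = ψ i := by
  -- For the first edge there is no `j < i`, so the hypothesis leaves its labelling free. The swap
  -- with `l` corrects that one and is trivial for all later edges.
  let l : Fin k := ⟨k - 1, by omega⟩
  refine ⟨fun i => if hx : x ∈ E i then (ψ i).trans (Equiv.swap (ψ i ⟨x, hx⟩) l) else ψ i,
    fun i hx => ?_, fun i j hji => ?_⟩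
  · simp only [hx, dif_pos, Equiv.trans_apply, Equiv.swap_apply_left, l]
    omega
  · by_cases hx : x ∈ E i
    · have h1 : ψ i ⟨x, hx⟩ = l := Fin.ext (by have := hψ i j hji hx; simp only [l]; omega)
      simp only [hx, dif_pos, h1, Equiv.swap_self]
      rfl
    · simp only [hx, dif_neg, not_false_eq_true]

end PerfectPacking

theorem theorem1 (k : ℕ) (hk : 2 ≤ k)
    (I : Finset (Finset (Fin k))) (hI : IsFullAntichain I)
    (J : Finset (Finset (Fin (k - 1))))
    (hJ : IsAntichain (· ⊆ ·) (J : Set (Finset (Fin (k - 1)))))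
    (α p : ℝ) (hα0 : 0 < α) (hα1 : α < 1) (hp0 : 0 < p) (hp1 : p < 1)
    {W : Type*} [Finite W] (F : UniformHypergraph W k) (hF : F.IsAdaptedPair I J) :
    ∃ μ : ℝ, 0 < μ ∧ ∃ n₀ : ℕ,
      ∀ (V : Type*) [Finite V] (H : UniformHypergraph V k),
        n₀ ≤ Nat.card V → Nat.card W ∣ Nat.card V →
        H.Disc I p μ →
        (∀ x : V, (H.link x).Disc J α μ) →
        F.HasPerfectPacking H := by
  classical
  have := Fintype.ofFinite W
  obtain ⟨⟨m', E', φ, hφ⟩, x, m, E, ψ, hψ⟩ := hF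
  have hcov := hI.2.2
  have hW1 : 0 < Fintype.card W := Fintype.card_pos_iff.2 ⟨x⟩
  obtain hW | hW : Fintype.card W = 1 ∨ 2 ≤ Fintype.card W := by omega
  · refine ⟨1, one_pos, 0, fun V _ H _ _ _ _ => ?_⟩
    have := Fintype.ofFinite V
    exact UniformHypergraph.hasPerfectPacking_of_card_eq_one hk F H hW
  obtain ⟨ψ', hlast, hψ'⟩ := exists_label_eq_last (by omega) x (fun i => (E i).1) ψ
    fun i j hji hx => ((hψ i j hji).2 hx).1
  have hψI : ∀ i j : Fin m, j < i → x ∉ (E i).1 →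
      ∃ A ∈ I, ∀ y : {y : W // y ∈ (E i).1}, y.1 ∈ (E j).1 → ψ' i y ∈ A := by
    intro i j hji hx
    rw [hψ' i j hji]
    exact (hψ i j hji).1 hx
  have hψJ : ∀ i j : Fin m, j < i → x ∈ (E i).1 →
      ∃ B ∈ J, ∀ y : {y : W // y ∈ (E i).1}, y.1 ∈ (E j).1 → y.1 ≠ x →
        ψ' i y ∈ B.map (Fin.castLEEmb (Nat.sub_le k 1)) := by
    intro i j hji hx
    rw [hψ' i j hji]
    exact ((hψ i j hji).2 hx).2
  set q := min p α with hq
  have hq0 : 0 < q := lt_min hp0 hα0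
  have hq1 : q ≤ 1 := (min_le_left _ _).trans hp1.le
  set M := Fintype.card W * m + Fintype.card {y : W // y ≠ x} * m' with hM
  -- `M` is the number of row and column edges in a grid, so the absorber density is about `q ^ M`;
  -- half of it is given up to the errors. The value of `ε` must be known before `ν`, since copies
  -- are sought in sets of density `ε`.
  obtain ⟨ε, hε, n₁, habsorb⟩ := exists_absorbing_threshold x hW (c := q ^ M / 2)
    (by positivity) (by linarith [pow_le_one₀ (n := M) hq0.le hq1])
  set a : ℝ := q ^ M with ha
  set b : ℝ := p ^ m' * ε ^ Fintype.card W with hb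
  have ha0 : 0 < a := by positivity
  have hb0 : 0 < b := by positivity
  set ν : ℝ := min (a / (4 * (M + 1))) (b / (2 * (m' + 1))) with hν
  have hν0 : 0 < ν := lt_min (by positivity) (by positivity)
  have hMν : M * ν ≤ a / 4 := by
    have h1 : ν * (4 * (M + 1)) ≤ a := (le_div_iff₀ (by positivity)).1 (min_le_left _ _)
    nlinarith
  have hmν : m' * ν < b / 2 := by
    have h1 : ν * (2 * (m' + 1)) ≤ b := (le_div_iff₀ (by positivity)).1 (min_le_right _ _)
    nlinarith
  set K : ℝ := (Fintype.card (W × {y : W // y ≠ x}) : ℝ) ^ 2 +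
    Fintype.card (W × {y : W // y ≠ x}) * Fintype.card W with hK
  have hdiv : ∀ (A B : ℝ), 0 < B → ∀ᶠ n : ℕ in Filter.atTop, A / n < B := fun A B hB =>
    (tendsto_const_div_atTop_nhds_zero_nat A).eventually (gt_mem_nhds hB)
  obtain ⟨n₂, hn₂⟩ := Filter.eventually_atTop.1
    (((hdiv ((k : ℝ) ^ 2) (ν / 2) (by positivity)).and
      (hdiv K (a / 4) (by positivity))).and
      ((hdiv ((Fintype.card W : ℝ) ^ 2) (b / 2) (by positivity)).and
      (Filter.eventually_gt_atTop 0)))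
  have hkk : (0 : ℝ) < (k : ℝ) ^ k := by
    have : (0 : ℝ) < k := by exact_mod_cast (by omega : 0 < k)
    positivity
  -- The passage to ordered tuples multiplies `μ` by `k ^ k`, leaving `ν / 2`; the other half of `ν`
  -- pays for the degenerate tuples, a proportion at most `k ^ 2 / n`.
  refine ⟨ν / (2 * (k : ℝ) ^ k), by positivity, max n₁ n₂, fun V _ H hn hdvd hH hlink => ?_⟩
  have := Fintype.ofFinite V
  rw [Nat.card_eq_fintype_card] at hn
  rw [Nat.card_eq_fintype_card, Nat.card_eq_fintype_card] at hdvd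
  obtain ⟨⟨hnk, hnK⟩, hnW, hV⟩ := hn₂ _ ((le_max_right _ _).trans hn)
  set ν' : ℝ := ν / (2 * (k : ℝ) ^ k) * (k : ℝ) ^ k + (k : ℝ) ^ 2 / Fintype.card V with hν'
  have hν'0 : 0 ≤ ν' := by positivity
  have hν'ν : ν' ≤ ν := by
    have : ν / (2 * (k : ℝ) ^ k) * (k : ℝ) ^ k = ν / 2 := by field_simp
    rw [hν', this]
    linarith
  have hD := hH.orderedDisc (by omega) (by positivity) hp0.le hp1.le hV
  have hDlink := fun u => (hlink u).orderedDisc_link hk (by positivity) hα0.le hα1.le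
  refine habsorb F H ((le_max_left _ _).trans hn) hdvd (fun S hS => ?_) fun v => ?_
  · refine exists_labeledCopy_mem hcov E' φ hφ hp0.le hp1.le hν'0 hε.le ?_ hV hS ?_
    · convert hD
    · have : m' * ν' ≤ m' * ν := by gcongr
      linarith
  · have habs := le_numSat_isAbsorber hcov E' φ hφ x E ψ' hlast hψI hψJ hq0.le hq1
      (min_le_left _ _) (min_le_right _ _) hν'0 (by convert hD)
      (fun u => by convert hDlink u) hV v
    refine le_trans ?_ habs
    refine mul_le_mul_of_nonneg_right ?_ (by positivity)
    have : (M : ℝ) * ν' ≤ M * ν := by gcongr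
    linarith
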